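/- Let $(M,\tau)$ be a finite von Neumann algebra, i.e. $M\subset\mathcal B(K)$ is a von Neumann algebra with a faithful normal tracial state $\tau$. Put $\|x\|_2=\tau(x^*x)^{1/2}$, let $L^2M$ be the completion of $M$ in $\|\cdot\|_2$, write $\hat x\in L^2M$ for the vector given by $x\in M$, and let $M\subset\mathcal B(L^2M)$ be the standard representation ($x\hat y=\widehat{xy}$). Let $\mathcal K(L^2M)$ be the set of compact operators, and let $s^*(\mathcal B(L^2M))$ be the set of smooth operators: those $T\in\mathcal B(L^2M)$ for which $x\mapsto xT$ and $x\mapsto Tx$ are continuous from the unit ball of $M$ with the $s^*$-topology (the strong* operator topology) to $\mathcal B(L^2M)$ with the norm topology. An orthogonal projection $p$ of $L^2M$ onto a closed subspace $\mathcal H_0$ is called s-smooth if $\mathcal H_0\subset\hat M$ and there is $C>0$ with $\|x\|\le C\|x\|_2$ for all $x\in M$ with $\hat x\in\mathcal H_0$. "Atomic" means that every nonzero projection of $M$ dominates a minimal projection of $M$; "diffuse" means that there are no minimal projections. 1. If $M$ is atomic, then $s^*(\mathcal B(L^2M))=\mathcal K(L^2M)$. 2. Assume that $M$ is diffuse. Let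 $A\subset M$ be a diffuse abelian von Neumann subalgebra (with the unit of $M$) such that $L^2(A,\tau)$ is separable, and let $(\xi_n)_{n\in\mathbb N}\subset L^2(A,\tau)$ be a sequence of independent identically distributed real-valued non-degenerate Gaussian random variables; that is, for some identification of $(A,\tau)$ with $(L^\infty(X,\mu),\int\cdot\,d\mu)$, $\mu$ a probability measure, and the corresponding identification of $L^2(A,\tau)$ with $L^2(X,\mu)$, the $\xi_n$ are independent and all have the law $N(m,v)$, with $m\in\mathbb R$ and $v>0$. Then the orthogonal projection $p$ of $L^2M$ onto the closed linear span of $\{\xi_n\}_n$ is in $s^*(\mathcal B(L^2M))$, and $p$ is not compact. Moreover, $\mathcal K(L^2M)\subsetneq s^*(\mathcal B(L^2M))$ for every diffuse $M$. 3. If $M$ is diffuse and abelian, then every s-smooth projection $p\in\mathcal B(L^2M)$ has finite rank. 4. Assume that $M$ is of type $\mathrm{II}_1$. If $(u_n)_{n\in\mathbb N}\subset M$ is a sequence of selfadjoint unitaries with $\tau(u_n)=0$ for all $n$ and $u_iu_j=-u_ju_i$ for all $i\ne j$, then $\{\hat u_n\}_n$ is orthonormal, and the orthogonal projection of $L^2M$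 onto the Hilbert subspace with orthonormal basis $\{\hat u_n\}_n$ is s-smooth and of infinite rank. -/

import Mathlib

open MeasureTheory ProbabilityTheory
open scoped ComplexOrder InnerProductSpace ENNReal NNReal

/-! ### A von Neumann algebra as an ordered C*-algebra -/

namespace VonNeumannAlgebra

variable {K : Type*} [NormedAddCommGroup K] [InnerProductSpace ℂ K] [CompleteSpace K]

instance instSMulMemClass : SMulMemClass (VonNeumannAlgebra K) ℂ (K →L[ℂ] K) where
  smul_mem {s} r _ hx := s.toStarSubalgebra.smul_mem hx r

theorem isClosed_coe (M : VonNeumannAlgebra K) : IsClosed (M : Set (K →L[ℂ] K)) := by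
  rw [← M.centralizer_centralizer]
  exact Set.isClosed_centralizer _

/-- The C*-algebra structure that `M` inherits from `B(K)`. -/
noncomputable instance instCStarAlgebra (M : VonNeumannAlgebra K) : CStarAlgebra M :=
  StarSubalgebra.cstarAlgebra M (h_closed := M.isClosed_coe)

/-- The order that `M` inherits from `B(K)` (where `0 ≤ x` means that `x` is a positive operator)
is the order of the C*-algebra `M`: a positive element of `M` has its square root in `M`. -/
instance instStarOrderedRing (M : VonNeumannAlgebra K) : StarOrderedRing M := by
  refine StarOrderedRing.of_nonneg_iff' (fun {x y} h z => ?_) (fun x => ⟨fun hx => ?_, ?_⟩)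
  · change (z : K →L[ℂ] K) + x ≤ z + y
    exact add_le_add le_rfl h
  · have hx' : (0 : K →L[ℂ] K) ≤ x := hx
    have hs : CFC.sqrt (x : K →L[ℂ] K) ∈ M := by
      rw [← SetLike.mem_coe, ← M.centralizer_centralizer, Set.mem_centralizer_iff]
      intro m hm
      have hc : Commute (x : K →L[ℂ] K) m := (Set.mem_centralizer_iff.mp hm) x x.2
      have := hc.cfc_nnreal NNReal.sqrt
      rw [CFC.sqrt_eq_cfc]
      exact this.symm
    refine ⟨⟨_, hs⟩, Subtype.ext ?_⟩
    change (x : K →L[ℂ] K) = star (CFC.sqrt (x : K →L[ℂ] K)) * CFC.sqrt (x : K →L[ℂ] K)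
    rw [(CFC.sqrt_nonneg (x : K →L[ℂ] K)).isSelfAdjoint.star_eq, CFC.sqrt_mul_sqrt_self _ hx']
  · rintro ⟨s, rfl⟩
    change (0 : K →L[ℂ] K) ≤ star (s : K →L[ℂ] K) * s
    exact star_mul_self_nonneg _

/-- A minimal projection of `M`: a nonzero projection `p ∈ M` such that the only projections of `M`
below `p` are `0` and `p`. -/
def IsMinimalProjection (M : VonNeumannAlgebra K) (p : M) : Prop :=
  IsStarProjection p ∧ p ≠ 0 ∧ ∀ q : M, IsStarProjection q → q * p = q → q = 0 ∨ q = p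

/-- `M` is atomic: every nonzero projection of `M` dominates a minimal projection of `M`. -/
def IsAtomicVN (M : VonNeumannAlgebra K) : Prop :=
  ∀ p : M, IsStarProjection p → p ≠ 0 → ∃ q : M, M.IsMinimalProjection q ∧ q * p = q

/-- `M` is diffuse: it has no minimal projections. -/
def IsDiffuse (M : VonNeumannAlgebra K) : Prop :=
  ∀ p : M, ¬ M.IsMinimalProjection p

/-- `M` is abelian. -/
def IsAbelian (M : VonNeumannAlgebra K) : Prop :=
  ∀ x y : M, x * y = y * x

/-- `M` is of type `II₁`: it is finite (every isometry in `M` is unitary) and it has no nonzero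
abelian projection, i.e. no nonzero projection `p ∈ M` with `pMp` commutative. -/
def IsTypeII1 (M : VonNeumannAlgebra K) : Prop :=
  (∀ w : M, star w * w = 1 → w * star w = 1) ∧
  ∀ p : M, IsStarProjection p →
    (∀ x y : M, (p * x * p) * (p * y * p) = (p * y * p) * (p * x * p)) → p = 0

/-- The strong* operator topology on `M ⊆ B(K)`: the coarsest topology making `x ↦ x ζ` and
`x ↦ x* ζ` continuous for all `ζ ∈ K`. On the unit ball of `M`, the only place where it is used,
it coincides with the σ-strong* topology, which does not depend on the choice of `K`. -/
noncomputable abbrev strongStarTopology (M : VonNeumannAlgebra K) : TopologicalSpace M :=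
  TopologicalSpace.induced
    (fun x : M => ((fun ζ : K => (x : K →L[ℂ] K) ζ, fun ζ : K => (star (x : K →L[ℂ] K)) ζ) :
      (K → K) × (K → K)))
    inferInstance

/-- The smooth part `s*_M(B(H))` of the `M`-bimodule `B(H)`, for a representation `π` of `M` on
`H`: the set of the `T ∈ B(H)` such that `x ↦ π(x) T` and `x ↦ T π(x)` are continuous from the
closed unit ball of `M` with the strong* topology to `B(H)` with the norm topology. -/
def smoothPart (M : VonNeumannAlgebra K)
    {H : Type*} [NormedAddCommGroup H] [InnerProductSpace ℂ H] [CompleteSpace H]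
    (π : M →⋆ₐ[ℂ] (H →L[ℂ] H)) : Set (H →L[ℂ] H) :=
  {T | @ContinuousOn M (H →L[ℂ] H) M.strongStarTopology inferInstance
        (fun x => π x * T) {x | ‖x‖ ≤ 1} ∧
       @ContinuousOn M (H →L[ℂ] H) M.strongStarTopology inferInstance
        (fun x => T * π x) {x | ‖x‖ ≤ 1}}

/-- `τ` is a faithful normal tracial state on `M`. Here "normal" is ultraweak continuity:
`τ(x) = ∑ₖ ⟨ηₖ, x ζₖ⟩` for square summable sequences of vectors `ζ`, `η`. -/
structure IsFaithfulNormalTracialState (M : VonNeumannAlgebra K) (τ : M →ₚ[ℂ] ℂ) : Prop where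
  map_one : τ 1 = 1
  tracial : ∀ x y : M, τ (x * y) = τ (y * x)
  faithful : ∀ x : M, τ (star x * x) = 0 → x = 0
  normal : ∃ ζ η : ℕ → K, Summable (fun k => ‖ζ k‖ ^ 2) ∧ Summable (fun k => ‖η k‖ ^ 2) ∧
    ∀ x : M, HasSum (fun k => ⟪η k, (x : K →L[ℂ] K) (ζ k)⟫_ℂ) (τ x)

/-- `L²M = L²(M,τ)`: the Hilbert space completion of `M` for `⟨x, y⟩ = τ(x* y)`. -/
noncomputable abbrev L2 {M : VonNeumannAlgebra K} (τ : M →ₚ[ℂ] ℂ) := τ.GNS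

/-- The element `x̂` of `L²M` given by `x ∈ M`. -/
noncomputable def hat {M : VonNeumannAlgebra K} (τ : M →ₚ[ℂ] ℂ) (x : M) : L2 τ :=
  ((τ.toPreGNS x : τ.PreGNS) : UniformSpace.Completion τ.PreGNS)

/-- The standard representation of `M` on `L²M`, extending left multiplication `x ŷ = (xy)^`. -/
noncomputable abbrev standardRep {M : VonNeumannAlgebra K} (τ : M →ₚ[ℂ] ℂ) :
    M →⋆ₐ[ℂ] (L2 τ →L[ℂ] L2 τ) := τ.gnsStarAlgHom

theorem inner_hat_hat {M : VonNeumannAlgebra K} (τ : M →ₚ[ℂ] ℂ) (x y : M) :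
    ⟪hat τ x, hat τ y⟫_ℂ = τ (star x * y) := by
  rw [hat, hat, UniformSpace.Completion.inner_coe, PositiveLinearMap.preGNS_inner_def]
  simp

theorem standardRep_hat {M : VonNeumannAlgebra K} (τ : M →ₚ[ℂ] ℂ) (x y : M) :
    standardRep τ x (hat τ y) = hat τ (x * y) := by
  simp [hat]

/-- `p` is an s-smooth projection of `L²M`: it is the orthogonal projection onto a closed subspace
`H₀ ⊆ M̂` for which there is `C > 0` with `‖x‖ ≤ C ‖x‖₂` for all `x ∈ H₀`. -/
def IsSSmooth {M : VonNeumannAlgebra K} (τ : M →ₚ[ℂ] ℂ) (p : L2 τ →L[ℂ] L2 τ) : Prop :=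
  IsStarProjection p ∧ ∃ C : ℝ, 0 < C ∧
    ∀ ξ ∈ LinearMap.range (p : L2 τ →ₗ[ℂ] L2 τ), ∃ x : M, hat τ x = ξ ∧ ‖x‖ ≤ C * ‖ξ‖

/-- An identification of `(A, τ)`, for a von Neumann subalgebra `A` of `M`, with
`(L^∞(X, μ), ∫ · dμ)`: a *-isomorphism `θ` of `L^∞(X, μ)` onto `A` that carries the integral to
`τ`, together with the isometry `U` of `L²(X, μ)` onto `L²(A, τ) ⊆ L²M` that extends it. -/
structure LInftyModel {M : VonNeumannAlgebra K} (τ : M →ₚ[ℂ] ℂ) (A : VonNeumannAlgebra K)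
    {X : Type*} [MeasurableSpace X] (μ : Measure X) where
  θ : Lp ℂ ∞ μ →ₗ[ℂ] M
  injective : Function.Injective θ
  range_eq : Set.range θ = {x : M | (x : K →L[ℂ] K) ∈ A}
  map_mul : ∀ f g h : Lp ℂ ∞ μ, (∀ᵐ t ∂μ, h t = f t * g t) → θ h = θ f * θ g
  map_star : ∀ f h : Lp ℂ ∞ μ, (∀ᵐ t ∂μ, h t = star (f t)) → θ h = star (θ f)
  trace_eq : ∀ f : Lp ℂ ∞ μ, τ (θ f) = ∫ t, f t ∂μ
  U : Lp ℂ 2 μ →ₗᵢ[ℂ] L2 τ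
  U_eq : ∀ (f : Lp ℂ ∞ μ) (g : Lp ℂ 2 μ), (∀ᵐ t ∂μ, g t = f t) → U g = hat τ (θ f)

/-- The orthogonal projection of a Hilbert space onto the closed linear span of a sequence. -/
noncomputable def spanProj {H : Type*} [NormedAddCommGroup H] [InnerProductSpace ℂ H]
    [CompleteSpace H] (ξ : ℕ → H) : H →L[ℂ] H :=
  (Submodule.span ℂ (Set.range ξ)).topologicalClosure.starProjection

end VonNeumannAlgebra

open VonNeumannAlgebra

/-!
On the unit ball of `M`, strong* convergence implies convergence in `‖·‖₂` because the trace is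
normal (`tendsto_norm_hat`). So `T` is smooth as soon as `‖xT‖` and `‖xT*‖` become small with
`‖x‖₂`, uniformly for bounded `x` (`mem_smoothPart_of_norm_le`). Compact operators have this
property, since `x ↦ xξ` is `‖·‖₂`-continuous on bounded sets for every `ξ ∈ L²M`
(`mem_smoothPart_of_isCompactOperator`).

*Atomic case.* The unit of `M` is the strong* sum of a family of orthogonal minimal projections
(`IsAtomicVN.exists_family`). If `e` and `f` are minimal then `eMf` has dimension at most one, and
it vanishes unless `τ(e) = τ(f)`; as the trace is finite, `eL²M` is finite-dimensional
(`IsMinimalProjection.isCompactOperator`). For smooth `T`, the operators `∑ eT` over finite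
subfamilies therefore are compact, and they converge to `T` in norm.

*Gaussian and Rademacher projections.* For `ξ ∈ L²(A)` the trace property and the Cauchy-Schwarz
inequality give `‖xξ‖² ≤ ‖x‖ ‖x‖₂ ‖ξ‖₄²` (`norm_hat_mul_sq_le`, and
`LInftyModel.norm_standardRep_sq_le` for unbounded `ξ`). Hence a projection onto a subspace of
`L²(A)` on which the norms `‖·‖₄` and `‖·‖₂` are equivalent is smooth
(`spanProj_mem_smoothPart`). The span of independent Gaussian variables is such a subspace, because
its elements have Gaussian real and imaginary parts (`exists_integral_norm_pow_four_le`). That some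
smooth operator is not compact for every diffuse `M` is shown by the span of a Rademacher sequence
(`IsDiffuse.exists_mem_smoothPart`); this avoids having to realize Gaussian variables in `M`. The
sequence is built from a maximal chain of projections, which takes every trace value in `[0, 1]`
when `M` is diffuse (`IsDiffuse.exists_flow`).

*Abelian case.* If `‖x‖ ≤ C ‖x‖₂` on the range of `p`, then an orthonormal family `x₁, …, xₙ` in the
range satisfies `∑ |xᵢ|² ≤ C²` pointwise on the spectrum of `M`
(`norm_sum_star_mul_le`), and applying `τ` gives `n ≤ C²` (`IsSSmooth.finiteDimensional`).

*Anticommuting unitaries.* For `x = ∑ cᵢ uᵢ` one has `x*x + xx* = 2 ∑ |cᵢ|²`, so that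
`‖x‖ ≤ √2 ‖x‖₂` (`norm_sum_smul_sq_le`), and this inequality passes to the closed span
(`isSSmooth_spanProj`).
-/

open VonNeumannAlgebra

namespace VonNeumannAlgebra

open Filter Topology

variable {K : Type*} [NormedAddCommGroup K] [InnerProductSpace ℂ K] [CompleteSpace K]
  {M : VonNeumannAlgebra K} {τ : M →ₚ[ℂ] ℂ}

/-! ### The trace norm -/

theorem hat_add (x y : M) : hat τ (x + y) = hat τ x + hat τ y := by
  simp [hat, UniformSpace.Completion.coe_add]

theorem hat_smul (c : ℂ) (x : M) : hat τ (c • x) = c • hat τ x := by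
  simp [hat, UniformSpace.Completion.coe_smul]

/-- The map `x ↦ x̂` as a linear map. -/
noncomputable def hatₗ (τ : M →ₚ[ℂ] ℂ) : M →ₗ[ℂ] L2 τ where
  toFun := hat τ
  map_add' := hat_add
  map_smul' := hat_smul

theorem hat_zero : hat τ (0 : M) = 0 := map_zero (hatₗ τ)

theorem hat_sub (x y : M) : hat τ (x - y) = hat τ x - hat τ y := map_sub (hatₗ τ) x y

theorem hat_sum {ι : Type*} (s : Finset ι) (x : ι → M) :
    hat τ (∑ i ∈ s, x i) = ∑ i ∈ s, hat τ (x i) := map_sum (hatₗ τ) x s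

theorem norm_hat_sq (x : M) : ((‖hat τ x‖ ^ 2 : ℝ) : ℂ) = τ (star x * x) := by
  rw [← inner_hat_hat, inner_self_eq_norm_sq_to_K]; norm_cast

theorem norm_hat_sq_re (x : M) : ‖hat τ x‖ ^ 2 = (τ (star x * x)).re := by
  rw [← norm_hat_sq, Complex.ofReal_re]

theorem denseRange_hat : DenseRange (hat τ) :=
  UniformSpace.Completion.denseRange_coe.comp τ.toPreGNS.surjective.denseRange
    (UniformSpace.Completion.continuous_coe _)

theorem norm_standardRep_le (x : M) : ‖standardRep τ x‖ ≤ ‖x‖ :=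
  NonUnitalStarAlgHom.norm_apply_le (standardRep τ) x

theorem norm_hat_mul_le (x y : M) : ‖hat τ (x * y)‖ ≤ ‖x‖ * ‖hat τ y‖ := by
  rw [← standardRep_hat]
  exact ((standardRep τ x).le_opNorm _).trans (by gcongr; exact norm_standardRep_le x)


theorem norm_hat_star (hτ : M.IsFaithfulNormalTracialState τ) (x : M) :
    ‖hat τ (star x)‖ = ‖hat τ x‖ := by
  rw [← sq_eq_sq₀ (norm_nonneg _) (norm_nonneg _), norm_hat_sq_re, norm_hat_sq_re, star_star,
    hτ.tracial]

/-- Right multiplication is bounded for `‖·‖₂`, by the trace property. -/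
theorem norm_hat_mul_le' (hτ : M.IsFaithfulNormalTracialState τ) (x y : M) :
    ‖hat τ (x * y)‖ ≤ ‖hat τ x‖ * ‖y‖ := by
  rw [← norm_hat_star hτ, star_mul, ← norm_hat_star hτ x, mul_comm ‖_‖, ← norm_star y]
  exact norm_hat_mul_le _ _

theorem norm_hat_one (hτ : M.IsFaithfulNormalTracialState τ) : ‖hat τ (1 : M)‖ = 1 := by
  have := norm_hat_sq_re (τ := τ) (1 : M)
  rw [star_one, one_mul, hτ.map_one, Complex.one_re] at this
  nlinarith [norm_nonneg (hat τ (1 : M))]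

theorem norm_hat_le (hτ : M.IsFaithfulNormalTracialState τ) (x : M) : ‖hat τ x‖ ≤ ‖x‖ := by
  simpa [norm_hat_one hτ] using norm_hat_mul_le (τ := τ) x 1

theorem hat_injective (hτ : M.IsFaithfulNormalTracialState τ) : Function.Injective (hat τ) := by
  intro x y h
  rw [← sub_eq_zero] at h ⊢
  rw [← hat_sub] at h
  refine hτ.faithful _ ?_
  rw [← norm_hat_sq, h]
  simp

/-- Cauchy-Schwarz for the trace. -/
theorem norm_trace_mul_le (x y : M) : ‖τ (star x * y)‖ ≤ ‖hat τ x‖ * ‖hat τ y‖ := by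
  rw [← inner_hat_hat]
  exact norm_inner_le_norm _ _

/-- A bounded net of `M` that converges to `0` strongly converges to `0` in `‖·‖₂`. This is where
normality of the trace is used. -/
theorem tendsto_norm_hat (hτ : M.IsFaithfulNormalTracialState τ) {ι : Type*} {l : Filter ι}
    {z : ι → M} {C : ℝ} (hb : ∀ᶠ i in l, ‖z i‖ ≤ C)
    (hz : ∀ ζ : K, Tendsto (fun i => (z i : K →L[ℂ] K) ζ) l (𝓝 0)) :
    Tendsto (fun i => ‖hat τ (z i)‖) l (𝓝 0) := by
  obtain ⟨ζ, η, hζ, hη, hs⟩ := hτ.normal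
  have hinner : ∀ (x : M) (a b : K),
      ⟪a, ((star x * x : M) : K →L[ℂ] K) b⟫_ℂ = ⟪(x : K →L[ℂ] K) a, (x : K →L[ℂ] K) b⟫_ℂ := by
    intro x a b
    change ⟪a, ((star (x : K →L[ℂ] K)) * (x : K →L[ℂ] K)) b⟫_ℂ = _
    exact ContinuousLinearMap.adjoint_inner_right (x : K →L[ℂ] K) a ((x : K →L[ℂ] K) b)
  have key : Tendsto (fun i => ∑' k, ⟪(z i : K →L[ℂ] K) (η k), (z i : K →L[ℂ] K) (ζ k)⟫_ℂ) l
      (𝓝 (∑' _ : ℕ, (0 : ℂ))) := by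
    refine tendsto_tsum_of_dominated_convergence
      (bound := fun k => C ^ 2 * (‖η k‖ ^ 2 + ‖ζ k‖ ^ 2)) ((hη.add hζ).mul_left _)
      (fun k => by simpa using (hz (η k)).inner (𝕜 := ℂ) (hz (ζ k))) ?_
    filter_upwards [hb] with i hi k
    have hle : ∀ a : K, ‖(z i : K →L[ℂ] K) a‖ ≤ C * ‖a‖ := fun a =>
      ((z i : K →L[ℂ] K).le_opNorm a).trans (by gcongr; exact hi)
    have hC : 0 ≤ C := (norm_nonneg _).trans hi
    calc ‖⟪(z i : K →L[ℂ] K) (η k), (z i : K →L[ℂ] K) (ζ k)⟫_ℂ‖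
        ≤ ‖(z i : K →L[ℂ] K) (η k)‖ * ‖(z i : K →L[ℂ] K) (ζ k)‖ := norm_inner_le_norm _ _
      _ ≤ (C * ‖η k‖) * (C * ‖ζ k‖) := by gcongr <;> exact hle _
      _ ≤ C ^ 2 * (‖η k‖ ^ 2 + ‖ζ k‖ ^ 2) := by
        nlinarith [mul_nonneg (sq_nonneg C) (sq_nonneg (‖η k‖ - ‖ζ k‖)),
          mul_nonneg (sq_nonneg C) (mul_nonneg (norm_nonneg (η k)) (norm_nonneg (ζ k)))]
  have h2 : Tendsto (fun i => ‖hat τ (z i)‖ ^ 2) l (𝓝 0) := by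
    have := (Complex.continuous_re.tendsto _).comp key
    rw [tsum_zero, Complex.zero_re] at this
    refine this.congr fun i => ?_
    rw [norm_hat_sq_re, ← (hs _).tsum_eq]
    simp only [Function.comp, hinner]
  simpa using h2.sqrt

/-! ### The smooth part -/

theorem norm_star_clm {H : Type*} [NormedAddCommGroup H] [InnerProductSpace ℂ H]
    [CompleteSpace H] (T : H →L[ℂ] H) : ‖star T‖ = ‖T‖ := norm_star T

/-- A criterion for smoothness in terms of the trace norm; the strong* topology of `B(K)` only
enters through `tendsto_norm_hat`. -/
theorem mem_smoothPart_of_norm_le (hτ : M.IsFaithfulNormalTracialState τ) {T : L2 τ →L[ℂ] L2 τ}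
    (h : ∀ ε > 0, ∃ δ > 0, ∀ x : M, ‖x‖ ≤ 2 → ‖hat τ x‖ < δ →
      ‖standardRep τ x * T‖ ≤ ε ∧ ‖standardRep τ x * star T‖ ≤ ε) :
    T ∈ M.smoothPart (standardRep τ) := by
  have key : ∀ x : M, ‖x‖ ≤ 1 → ∀ ε > 0,
      ∀ᶠ y in @nhdsWithin M M.strongStarTopology x {x | ‖x‖ ≤ 1},
        ‖standardRep τ (y - x) * T‖ ≤ ε ∧ ‖T * standardRep τ (y - x)‖ ≤ ε := by
    intro x hx ε hε
    obtain ⟨δ, hδ, h⟩ := h ε hε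
    have hball : ∀ᶠ y in @nhdsWithin M M.strongStarTopology x {x | ‖x‖ ≤ 1}, ‖y - x‖ ≤ 2 := by
      let := M.strongStarTopology
      filter_upwards [self_mem_nhdsWithin] with y hy
      have hy : ‖y‖ ≤ 1 := hy
      linarith [norm_sub_le y x]
    have hlim : ∀ ζ : K, Tendsto (fun y : M => ((y - x : M) : K →L[ℂ] K) ζ)
        (@nhdsWithin M M.strongStarTopology x {x | ‖x‖ ≤ 1}) (𝓝 0) := by
      intro ζ
      have h1 : Tendsto (fun y : M => (y : K →L[ℂ] K) ζ) (@nhds M M.strongStarTopology x)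
          (𝓝 ((x : K →L[ℂ] K) ζ)) := by
        let := M.strongStarTopology
        have hc := continuous_induced_dom (t := inferInstance)
          (f := fun x : M => ((fun ζ : K => (x : K →L[ℂ] K) ζ,
          fun ζ : K => (star (x : K →L[ℂ] K)) ζ) : (K → K) × (K → K)))
        exact (((continuous_apply ζ).comp continuous_fst).comp hc).tendsto x
      have h2 : Tendsto (fun y : M => (y : K →L[ℂ] K) ζ)
          (@nhdsWithin M M.strongStarTopology x {x | ‖x‖ ≤ 1}) (𝓝 ((x : K →L[ℂ] K) ζ)) := by
        let := M.strongStarTopology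
        exact h1.mono_left nhdsWithin_le_nhds
      have h3 := h2.sub_const ((x : K →L[ℂ] K) ζ)
      rw [sub_self] at h3
      exact h3
    have hsmall := (tendsto_norm_hat hτ hball hlim).eventually (gt_mem_nhds hδ)
    filter_upwards [hball, hsmall] with y hy1 hy2
    refine ⟨(h _ hy1 hy2).1, ?_⟩
    -- `‖T y‖ = ‖y* T*‖`, and `y ↦ y*` preserves both norms.
    have := (h (star (y - x)) (by rwa [norm_star]) (by rwa [norm_hat_star hτ])).2
    rwa [map_star, ← star_mul, norm_star_clm] at this
  constructor <;>
  · intro x hx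
    refine Metric.tendsto_nhds.2 fun ε hε => ?_
    filter_upwards [key x hx (ε / 2) (by positivity)] with y hy
    rw [map_sub, sub_mul, mul_sub] at hy
    rw [dist_eq_norm]
    linarith [hy.1, hy.2]

/-- The adjoint of a compact operator is compact: if `T T*` maps a ball into a compact set, then
`‖T* u - T* v‖² ≤ ‖u - v‖ ‖T T* u - T T* v‖` bounds the covering numbers of its image. -/
theorem isCompactOperator_star {H : Type*} [NormedAddCommGroup H] [InnerProductSpace ℂ H]
    [CompleteSpace H] {T : H →L[ℂ] H} (hT : IsCompactOperator T) :
    IsCompactOperator (star T : H →L[ℂ] H) := by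
  have hTT : IsCompactOperator (T * star T : H →L[ℂ] H) := hT.comp_clm (star T : H →L[ℂ] H)
  refine (isCompactOperator_iff_isCompact_closure_image_closedBall
    (star T : H →L[ℂ] H).toLinearMap one_pos).2 ?_
  refine TotallyBounded.isCompact_of_isClosed (TotallyBounded.closure ?_) isClosed_closure
  have htb : TotallyBounded ((T * star T : H →L[ℂ] H) '' Metric.closedBall 0 1) :=
    (((hTT.isCompact_closure_image_closedBall (f := (T * star T : H →L[ℂ] H).toLinearMap)
      1)).totallyBounded).subset subset_closure
  refine Metric.totallyBounded_iff.2 fun ε hε => ?_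
  obtain ⟨t, htb, htf, hsub⟩ := Set.exists_subset_image_finite_and.1
    (Metric.finite_approx_of_totallyBounded htb (ε ^ 2 / 2) (by positivity))
  refine ⟨(star T : H →L[ℂ] H) '' t, htf.image _, ?_⟩
  rintro _ ⟨u, hu, rfl⟩
  obtain ⟨v, hv, huv⟩ : ∃ v ∈ t, dist ((T * star T) u) ((T * star T) v) < ε ^ 2 / 2 := by
    simpa using hsub ⟨u, hu, rfl⟩
  refine Set.mem_biUnion ⟨v, hv, rfl⟩ ?_
  have huv2 : ‖u - v‖ ≤ 2 := by
    have h1 := mem_closedBall_zero_iff.1 hu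
    have h2 := mem_closedBall_zero_iff.1 (htb hv)
    linarith [norm_sub_le u v]
  rw [dist_eq_norm, ← map_sub] at huv
  change dist ((star T : H →L[ℂ] H) u) ((star T : H →L[ℂ] H) v) < ε
  rw [dist_eq_norm, ← map_sub]
  refine lt_of_pow_lt_pow_left₀ 2 hε.le ?_
  have hsq : ‖(star T : H →L[ℂ] H) (u - v)‖ ^ 2 ≤ ‖u - v‖ * ‖(T * star T) (u - v)‖ := by
    rw [← inner_self_eq_norm_sq (𝕜 := ℂ), ContinuousLinearMap.star_eq_adjoint,
      ContinuousLinearMap.adjoint_inner_left]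
    exact re_inner_le_norm _ _
  nlinarith [norm_nonneg (u - v), norm_nonneg ((T * star T) (u - v))]

/-- The standard representation is strongly continuous on bounded sets for `‖·‖₂`. -/
theorem exists_norm_standardRep_le (hτ : M.IsFaithfulNormalTracialState τ) (ξ : L2 τ) {ε : ℝ}
    (hε : 0 < ε) :
    ∃ δ > 0, ∀ x : M, ‖x‖ ≤ 2 → ‖hat τ x‖ < δ → ‖standardRep τ x ξ‖ ≤ ε := by
  obtain ⟨y, hy⟩ := (denseRange_hat (τ := τ)).exists_dist_lt ξ (ε := ε / 4) (by positivity)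
  refine ⟨ε / (2 * (‖y‖ + 1)), by positivity, fun x hx hx' => ?_⟩
  have h1 : ‖standardRep τ x (ξ - hat τ y)‖ ≤ 2 * (ε / 4) :=
    ((standardRep τ x).le_opNorm _).trans (by
      rw [dist_eq_norm] at hy
      gcongr
      exact (norm_standardRep_le x).trans hx)
  have h2 : ‖standardRep τ x (hat τ y)‖ ≤ ε / 2 := by
    rw [standardRep_hat]
    refine (norm_hat_mul_le' hτ _ _).trans ?_
    calc ‖hat τ x‖ * ‖y‖ ≤ ε / (2 * (‖y‖ + 1)) * (‖y‖ + 1) := by gcongr; linarith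
      _ = ε / 2 := by field_simp
  calc ‖standardRep τ x ξ‖ = ‖standardRep τ x (ξ - hat τ y) + standardRep τ x (hat τ y)‖ := by
        rw [map_sub, sub_add_cancel]
    _ ≤ ε := (norm_add_le _ _).trans (by linarith)

/-- For compact `T`, pointwise smallness of `xξ` is uniform over the totally bounded image of the
unit ball under `T`. -/
theorem exists_norm_standardRep_mul_le (hτ : M.IsFaithfulNormalTracialState τ)
    {T : L2 τ →L[ℂ] L2 τ} (hT : IsCompactOperator T) {ε : ℝ} (hε : 0 < ε) :
    ∃ δ > 0, ∀ x : M, ‖x‖ ≤ 2 → ‖hat τ x‖ < δ → ‖standardRep τ x * T‖ ≤ ε := by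
  have htb : TotallyBounded (T '' Metric.closedBall 0 1) :=
    (((hT.isCompact_closure_image_closedBall (f := T.toLinearMap) 1)).totallyBounded).subset
      subset_closure
  obtain ⟨t, htf, hsub⟩ := Metric.totallyBounded_iff.1 htb (ε / 4) (by positivity)
  choose δ hδ h using fun ξ : L2 τ => exists_norm_standardRep_le hτ ξ (half_pos hε)
  obtain ⟨δ', hδ', hδt⟩ : ∃ δ' > 0, ∀ ξ ∈ t, δ' ≤ δ ξ := by
    obtain ⟨t, rfl⟩ := htf.exists_finset_coe
    rcases t.eq_empty_or_nonempty with rfl | hne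
    · exact ⟨1, one_pos, by simp⟩
    · exact ⟨t.inf' hne δ, (Finset.lt_inf'_iff _).2 fun ξ _ => hδ ξ,
        fun ξ hξ => Finset.inf'_le _ hξ⟩
  refine ⟨δ', hδ', fun x hx hx' => ?_⟩
  refine ContinuousLinearMap.opNorm_le_of_unit_norm hε.le fun u hu => ?_
  obtain ⟨ξ, hξt, hξ⟩ := Set.mem_iUnion₂.1 (hsub ⟨u, mem_closedBall_zero_iff.2 hu.le, rfl⟩)
  rw [Metric.mem_ball, dist_eq_norm] at hξ
  change ‖standardRep τ x (T u)‖ ≤ ε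
  have h1 : ‖standardRep τ x (T u - ξ)‖ ≤ 2 * (ε / 4) :=
    ((standardRep τ x).le_opNorm _).trans (by
      gcongr
      exact (norm_standardRep_le x).trans hx)
  have h2 := h ξ x hx (hx'.trans_le (hδt ξ hξt))
  calc ‖standardRep τ x (T u)‖ = ‖standardRep τ x (T u - ξ) + standardRep τ x ξ‖ := by
        rw [map_sub, sub_add_cancel]
    _ ≤ ε := (norm_add_le _ _).trans (by linarith)

theorem mem_smoothPart_of_isCompactOperator (hτ : M.IsFaithfulNormalTracialState τ)
    {T : L2 τ →L[ℂ] L2 τ} (hT : IsCompactOperator T) : T ∈ M.smoothPart (standardRep τ) := by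
  refine mem_smoothPart_of_norm_le hτ fun ε hε => ?_
  obtain ⟨δ₁, hδ₁, h₁⟩ := exists_norm_standardRep_mul_le hτ hT hε
  obtain ⟨δ₂, hδ₂, h₂⟩ := exists_norm_standardRep_mul_le hτ (isCompactOperator_star hT) hε
  exact ⟨min δ₁ δ₂, lt_min hδ₁ hδ₂, fun x hx hx' =>
    ⟨h₁ x hx (hx'.trans_le (min_le_left _ _)), h₂ x hx (hx'.trans_le (min_le_right _ _))⟩⟩

/-- Smoothness of the projection onto a closed span on which `‖xξ‖ ≤ C (‖x‖ ‖x‖₂)^{1/2} ‖ξ‖`.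
This bound expresses that the unit ball of the span is uniformly square integrable. -/
theorem spanProj_mem_smoothPart (hτ : M.IsFaithfulNormalTracialState τ) {ξ : ℕ → L2 τ} {C : ℝ}
    (hC : 0 ≤ C) (h : ∀ ζ ∈ Submodule.span ℂ (Set.range ξ), ∀ x : M,
      ‖standardRep τ x ζ‖ ^ 2 ≤ C * (‖x‖ * ‖hat τ x‖) * ‖ζ‖ ^ 2) :
    spanProj ξ ∈ M.smoothPart (standardRep τ) := by
  set V := (Submodule.span ℂ (Set.range ξ)).topologicalClosure
  have hcl : ∀ ζ ∈ V, ∀ x : M, ‖standardRep τ x ζ‖ ^ 2 ≤ C * (‖x‖ * ‖hat τ x‖) * ‖ζ‖ ^ 2 := by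
    intro ζ hζ x
    have hclosed : IsClosed
        {ζ : L2 τ | ‖standardRep τ x ζ‖ ^ 2 ≤ C * (‖x‖ * ‖hat τ x‖) * ‖ζ‖ ^ 2} :=
      isClosed_le (by fun_prop) (by fun_prop)
    exact closure_minimal (fun ζ hζ => h ζ hζ x) hclosed hζ
  refine mem_smoothPart_of_norm_le hτ fun ε hε => ?_
  refine ⟨ε ^ 2 / (2 * C + 1), by positivity, fun x hx hx' => ?_⟩
  have hsa : star (spanProj ξ) = spanProj ξ := (isSelfAdjoint_starProjection V).star_eq
  rw [hsa, and_self]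
  refine ContinuousLinearMap.opNorm_le_bound _ hε.le fun ζ => ?_
  change ‖standardRep τ x (V.starProjection ζ)‖ ≤ ε * ‖ζ‖
  refine le_of_sq_le_sq ?_ (by positivity)
  have hn : ‖V.starProjection ζ‖ ≤ ‖ζ‖ := V.norm_starProjection_apply_le ζ
  calc _ ≤ C * (‖x‖ * ‖hat τ x‖) * ‖V.starProjection ζ‖ ^ 2 :=
        hcl _ (V.starProjection_apply_mem ζ) x
    _ ≤ C * (2 * (ε ^ 2 / (2 * C + 1))) * ‖ζ‖ ^ 2 := by gcongr
    _ = (2 * C / (2 * C + 1)) * (ε ^ 2 * ‖ζ‖ ^ 2) := by ring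
    _ ≤ 1 * (ε ^ 2 * ‖ζ‖ ^ 2) := by
        gcongr
        rw [div_le_one (by positivity)]
        linarith
    _ = (ε * ‖ζ‖) ^ 2 := by ring

/-- A projection fixing a bounded sequence with uniformly separated terms is not compact. -/
theorem not_isCompactOperator_spanProj {H : Type*} [NormedAddCommGroup H] [InnerProductSpace ℂ H]
    [CompleteSpace H] {ξ : ℕ → H} {R δ : ℝ} (hδ : 0 < δ) (hR : ∀ n, ‖ξ n‖ ≤ R)
    (hsep : ∀ i j, i ≠ j → δ ≤ ‖ξ i - ξ j‖) : ¬ IsCompactOperator (spanProj ξ) := by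
  intro hc
  have hmem : ∀ n, ξ n ∈ closure (spanProj ξ '' Metric.closedBall 0 R) := by
    intro n
    refine subset_closure ⟨ξ n, mem_closedBall_zero_iff.2 (hR n), ?_⟩
    exact Submodule.starProjection_eq_self_iff.2
      (Submodule.le_topologicalClosure _ (Submodule.subset_span ⟨n, rfl⟩))
  obtain ⟨a, -, φ, hφ, hlim⟩ := (hc.isCompact_closure_image_closedBall
    (f := (spanProj ξ).toLinearMap) R).tendsto_subseq hmem
  obtain ⟨N, hN⟩ := Metric.cauchySeq_iff.1 hlim.cauchySeq δ hδ
  have := hN N le_rfl (N + 1) (by omega)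
  rw [dist_eq_norm] at this
  exact absurd this (not_lt.2 (hsep _ _ (hφ.injective.ne (by omega))))

theorem not_isCompactOperator_spanProj_of_orthonormal {H : Type*} [NormedAddCommGroup H]
    [InnerProductSpace ℂ H] [CompleteSpace H] {ξ : ℕ → H} (hξ : Orthonormal ℂ ξ) :
    ¬ IsCompactOperator (spanProj ξ) := by
  refine not_isCompactOperator_spanProj one_pos (fun n => (hξ.1 n).le) fun i j hij => ?_
  have h := norm_sub_sq (𝕜 := ℂ) (ξ i) (ξ j)
  rw [hξ.2 hij, hξ.1 i, hξ.1 j] at h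
  simp only [map_zero] at h
  nlinarith [norm_nonneg (ξ i - ξ j)]

/-! ### Projections of `M` -/

/-- A projection onto a subspace that is invariant under the commutant lies in `M`. -/
theorem starProjection_mem (V : Submodule ℂ K) [V.HasOrthogonalProjection]
    (h : ∀ y ∈ M.commutant, ∀ ζ ∈ V, y ζ ∈ V) : V.starProjection ∈ M := by
  refine (IsStarProjection.mem_iff isStarProjection_starProjection M).2 fun y hy => ?_
  rw [Module.End.mem_invtSubmodule, Submodule.range_starProjection]
  exact fun ζ hζ => h y hy ζ hζ

/-- Closed version of `starProjection_mem`: invariance has only to be checked before taking the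
closure. -/
theorem starProjection_topologicalClosure_mem (V : Submodule ℂ K)
    (h : ∀ y ∈ M.commutant, ∀ ζ ∈ V, y ζ ∈ V) : V.topologicalClosure.starProjection ∈ M := by
  refine starProjection_mem _ fun y hy ζ hζ => ?_
  have hm : Set.MapsTo y (V : Set K) V := fun ζ hζ => h y hy ζ hζ
  exact hm.closure y.continuous hζ

theorem isStarProjection_coe {p : M} :
    IsStarProjection (p : K →L[ℂ] K) ↔ IsStarProjection p := by
  simp only [isStarProjection_iff, IsIdempotentElem, IsSelfAdjoint, ← Subtype.coe_inj]
  rfl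

theorem commutant_apply_comm {y : K →L[ℂ] K} (hy : y ∈ M.commutant) (x : M) (ζ : K) :
    y ((x : K →L[ℂ] K) ζ) = (x : K →L[ℂ] K) (y ζ) := by
  have := mem_commutant_iff.1 hy x x.2
  exact (DFunLike.congr_fun this ζ).symm

theorem range_invariant {y : K →L[ℂ] K} (hy : y ∈ M.commutant) (x : M) {ζ : K}
    (hζ : ζ ∈ (x : K →L[ℂ] K).range) : y ζ ∈ (x : K →L[ℂ] K).range := by
  obtain ⟨η, rfl⟩ := hζ
  exact ⟨y η, (commutant_apply_comm hy x η).symm⟩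

/-- The left support of an element `y` of `M`: the projection onto the closure of the range of `y`,
characterized by `q y = y` and by the fact that every `z` with `z y = 0` satisfies `z q = 0`. -/
theorem exists_leftSupport (y : M) :
    ∃ q : M, IsStarProjection q ∧ q * y = y ∧ ∀ z : M, z * y = 0 → z * q = 0 := by
  set V := (y : K →L[ℂ] K).range.topologicalClosure with hV
  refine ⟨⟨V.starProjection, starProjection_topologicalClosure_mem _
    fun m hm ζ hζ => range_invariant hm y hζ⟩, isStarProjection_coe.1
      isStarProjection_starProjection, Subtype.ext ?_, fun z hz => Subtype.ext ?_⟩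
  · ext ζ
    exact Submodule.starProjection_eq_self_iff.2
      (Submodule.le_topologicalClosure _ ⟨ζ, rfl⟩)
  · ext ζ
    change (z : K →L[ℂ] K) (V.starProjection ζ) = 0
    have hz' : ∀ η, (z : K →L[ℂ] K) ((y : K →L[ℂ] K) η) = 0 := fun η =>
      DFunLike.congr_fun (congrArg (Subtype.val) hz) η
    have hcl : IsClosed {ζ : K | (z : K →L[ℂ] K) ζ = 0} := isClosed_eq (by fun_prop) (by fun_prop)
    refine closure_minimal ?_ hcl (V.starProjection_apply_mem ζ)
    rintro _ ⟨η, rfl⟩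
    exact hz' η

/-- The supremum of an increasing net of projections of `M`, as a strong limit. -/
theorem exists_tendsto_projection {ι : Type*} [Preorder ι] [IsDirectedOrder ι] [Nonempty ι]
    {e : ι → M} (he : ∀ i, IsStarProjection (e i)) (hmono : Monotone e) :
    ∃ q : M, IsStarProjection q ∧ (∀ i, e i ≤ q) ∧
      ∀ ζ : K, Tendsto (fun i => (e i : K →L[ℂ] K) ζ) atTop (𝓝 ((q : K →L[ℂ] K) ζ)) := by
  have hmul : ∀ i j, i ≤ j → e j * e i = e i := fun i j hij =>
    ((he i).le_iff_mul_eq_right (he j)).1 (hmono hij)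
  choose hop hproj using fun i =>
    isStarProjection_iff_eq_starProjection_range.1 (isStarProjection_coe.2 (he i))
  set U : ι → Submodule ℂ K := fun i => (e i : K →L[ℂ] K).range with hU
  have hUmono : Monotone U := by
    rintro i j hij _ ⟨ζ, rfl⟩
    exact ⟨(e i : K →L[ℂ] K) ζ, DFunLike.congr_fun (congrArg Subtype.val (hmul i j hij)) ζ⟩
  have hinv : ∀ y ∈ M.commutant, ∀ ζ ∈ ⨆ i, U i, y ζ ∈ ⨆ i, U i := by
    intro y hy ζ hζ
    have : ⨆ i, U i ≤ (⨆ i, U i).comap y.toLinearMap :=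
      iSup_le fun i ζ hζ => le_iSup U i (range_invariant hy (e i) hζ)
    exact this hζ
  have hlim := Submodule.starProjection_tendsto_closure_iSup U hUmono
  let q : M := ⟨_, starProjection_topologicalClosure_mem _ hinv⟩
  have hq : IsStarProjection q := isStarProjection_coe.1 isStarProjection_starProjection
  refine ⟨q, hq, fun i => ((he i).le_iff_mul_eq_right hq).2 (Subtype.ext ?_), fun ζ => ?_⟩
  · ext ζ
    exact Submodule.starProjection_eq_self_iff.2
      (Submodule.le_topologicalClosure _ (le_iSup U i ⟨ζ, rfl⟩))
  · refine (hlim ζ).congr fun i => ?_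
    exact (DFunLike.congr_fun (hproj i) ζ).symm

theorem norm_hat_sq_of_isStarProjection {p : M} (hp : IsStarProjection p) :
    τ p = ((‖hat τ p‖ ^ 2 : ℝ) : ℂ) := by
  rw [norm_hat_sq, hp.isSelfAdjoint.star_eq, hp.isIdempotentElem.eq]

theorem trace_re_le_one (hτ : M.IsFaithfulNormalTracialState τ) {p : M}
    (hp : IsStarProjection p) : (τ p).re ≤ 1 := by
  rw [norm_hat_sq_of_isStarProjection hp, Complex.ofReal_re]
  exact pow_le_one₀ (norm_nonneg _) ((norm_hat_le hτ p).trans (IsStarProjection.norm_le p hp))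

theorem eq_zero_of_trace_eq_zero (hτ : M.IsFaithfulNormalTracialState τ) {x : M} (hx : 0 ≤ x)
    (h : τ x = 0) : x = 0 := by
  obtain ⟨s, rfl⟩ := CStarAlgebra.nonneg_iff_eq_star_mul_self.1 hx
  rw [hτ.faithful s h, mul_zero]

theorem trace_re_pos (hτ : M.IsFaithfulNormalTracialState τ) {p : M}
    (hp : IsStarProjection p) (h0 : p ≠ 0) : 0 < (τ p).re := by
  rw [norm_hat_sq_of_isStarProjection hp, Complex.ofReal_re]
  have : hat τ p ≠ 0 := fun h => h0 (hat_injective hτ (h.trans hat_zero.symm))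
  positivity

theorem tendsto_hat (hτ : M.IsFaithfulNormalTracialState τ) {ι : Type*} {l : Filter ι}
    {e : ι → M} {q : M} (he : ∀ i, IsStarProjection (e i)) (hq : IsStarProjection q)
    (h : ∀ ζ : K, Tendsto (fun i => (e i : K →L[ℂ] K) ζ) l (𝓝 ((q : K →L[ℂ] K) ζ))) :
    Tendsto (fun i => hat τ (e i)) l (𝓝 (hat τ q)) := by
  rw [tendsto_iff_norm_sub_tendsto_zero]
  simp_rw [← hat_sub]
  refine tendsto_norm_hat hτ (C := 2) (Eventually.of_forall fun i => ?_) fun ζ => ?_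
  · linarith [norm_sub_le (e i) q, IsStarProjection.norm_le _ (he i),
      IsStarProjection.norm_le _ hq]
  · have := (h ζ).sub_const ((q : K →L[ℂ] K) ζ)
    rw [sub_self] at this
    exact this

theorem tendsto_trace_re (hτ : M.IsFaithfulNormalTracialState τ) {ι : Type*} {l : Filter ι}
    {e : ι → M} {q : M} (he : ∀ i, IsStarProjection (e i)) (hq : IsStarProjection q)
    (h : ∀ ζ : K, Tendsto (fun i => (e i : K →L[ℂ] K) ζ) l (𝓝 ((q : K →L[ℂ] K) ζ))) :
    Tendsto (fun i => (τ (e i)).re) l (𝓝 (τ q).re) := by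
  have h2 := (tendsto_hat hτ he hq h).norm.pow 2
  simpa only [norm_hat_sq_of_isStarProjection (he _), norm_hat_sq_of_isStarProjection hq,
    Complex.ofReal_re] using h2

/-! ### Minimal projections -/

/-- If `p` is minimal, a selfadjoint `z ∈ pMp` of trace zero vanishes: otherwise the left supports
of `z⁺` and `z⁻` are two nonzero orthogonal projections below `p`. -/
theorem IsMinimalProjection.eq_zero_of_isSelfAdjoint (hτ : M.IsFaithfulNormalTracialState τ)
    {p : M} (hp : M.IsMinimalProjection p) {z : M} (hz : IsSelfAdjoint z) (hpz : p * z = z)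
    (h0 : τ z = 0) : z = 0 := by
  obtain ⟨a, b, ha, hb, hab, hba, rfl⟩ : ∃ a b : M, 0 ≤ a ∧ 0 ≤ b ∧ a * b = 0 ∧ b * a = 0 ∧
      z = a - b := ⟨z⁺, z⁻, CFC.posPart_nonneg z, CFC.negPart_nonneg z,
    CFC.posPart_mul_negPart z, CFC.negPart_mul_posPart z, (CFC.posPart_sub_negPart z).symm⟩
  have hasa : star a = a := ha.isSelfAdjoint.star_eq
  have hbsa : star b = b := hb.isSelfAdjoint.star_eq
  suffices a = 0 ∨ b = 0 by
    rcases this with rfl | rfl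
    · rw [zero_sub, map_neg, neg_eq_zero] at h0
      rw [eq_zero_of_trace_eq_zero hτ hb h0, sub_zero]
    · rw [sub_zero] at h0
      rw [eq_zero_of_trace_eq_zero hτ ha h0, sub_zero]
  obtain ⟨q, hq, hqa, hqs⟩ := exists_leftSupport a
  have hpa : (1 - p) * a = 0 := by
    rw [← CStarRing.mul_star_self_eq_zero_iff, star_mul, hasa, mul_assoc, ← mul_assoc a a]
    have h1 : (a - b) * a = a * a := by rw [sub_mul, hba, sub_zero]
    rw [← h1, ← mul_assoc, ← mul_assoc, sub_mul 1 p, one_mul, hpz, sub_self, zero_mul, zero_mul]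
  have hpq : p * q = q := by
    have := hqs _ hpa
    rwa [sub_mul, one_mul, sub_eq_zero, eq_comm] at this
  have hqp : q * p = q := by
    simpa [hq.isSelfAdjoint.star_eq, hp.1.isSelfAdjoint.star_eq] using congrArg star hpq
  rcases hp.2.2 q hq hqp with rfl | rfl
  · left
    rw [← hqa, zero_mul]
  · right
    have hbq : b * q = 0 := hqs b hba
    have h1 : b * (q * (a - b)) = -(b * b) := by rw [hpz, mul_sub, hba, zero_sub]
    rw [← mul_assoc, hbq, zero_mul, eq_comm, neg_eq_zero] at h1
    rw [← CStarRing.mul_star_self_eq_zero_iff, hbsa, h1]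

/-- The case of a general `z`, by decomposition into real and imaginary part. -/
theorem IsMinimalProjection.eq_zero (hτ : M.IsFaithfulNormalTracialState τ)
    {p : M} (hp : M.IsMinimalProjection p) {z : M} (hpz : p * z = z) (hzp : z * p = z)
    (h0 : τ z = 0) : z = 0 := by
  have hps := hp.1.isSelfAdjoint.star_eq
  have hpz' : p * star z = star z := by simpa [hps] using congrArg star hzp
  have h0' : τ (star z) = 0 := by rw [map_star τ, h0, star_zero]
  have h1 : z + star z = 0 :=
    hp.eq_zero_of_isSelfAdjoint hτ (by rw [IsSelfAdjoint, star_add, star_star, add_comm])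
      (by rw [mul_add, hpz, hpz']) (by rw [map_add, h0, h0', add_zero])
  have h2 : Complex.I • (z - star z) = 0 :=
    hp.eq_zero_of_isSelfAdjoint hτ
      (by rw [IsSelfAdjoint, star_smul, star_sub, star_star, ← neg_sub z, smul_neg, ← neg_smul]
          simp)
      (by rw [mul_smul_comm, mul_sub, hpz, hpz'])
      (by rw [map_smul, map_sub, h0, h0', sub_zero, smul_zero])
  have h3 := (smul_eq_zero_iff_right Complex.I_ne_zero).1 h2
  have h4 : (2 : ℂ) • z = 0 := by
    have : (2 : ℂ) • z = (z + star z) + (z - star z) := by rw [two_smul]; abel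
    rw [this, h1, h3, add_zero]
  exact (smul_eq_zero_iff_right two_ne_zero).1 h4

theorem IsMinimalProjection.trace_ne_zero (hτ : M.IsFaithfulNormalTracialState τ)
    {p : M} (hp : M.IsMinimalProjection p) : τ p ≠ 0 := fun h =>
  (trace_re_pos hτ hp.1 hp.2.1).ne' (by rw [h, Complex.zero_re])

/-- If `p` is minimal, then `pMp = ℂ p`. -/
theorem IsMinimalProjection.exists_smul (hτ : M.IsFaithfulNormalTracialState τ)
    {p : M} (hp : M.IsMinimalProjection p) {z : M} (hpz : p * z = z) (hzp : z * p = z) :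
    ∃ c : ℂ, z = c • p := by
  refine ⟨τ z / τ p, sub_eq_zero.1 (hp.eq_zero hτ ?_ ?_ ?_)⟩
  · rw [mul_sub, hpz, mul_smul_comm, hp.1.isIdempotentElem.eq]
  · rw [sub_mul, hzp, smul_mul_assoc, hp.1.isIdempotentElem.eq]
  · rw [map_sub, map_smul, smul_eq_mul, div_mul_cancel₀ _ (hp.trace_ne_zero hτ), sub_self]

/-- For minimal projections `p` and `q`, either `pMq = 0`, or `p` and `q` have the same trace and
`pMq` is one-dimensional. -/
theorem IsMinimalProjection.corner (hτ : M.IsFaithfulNormalTracialState τ)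
    {p q : M} (hp : M.IsMinimalProjection p) (hq : M.IsMinimalProjection q) {x : M}
    (hpx : p * x = x) (hxq : x * q = x) (hx : x ≠ 0) :
    τ p = τ q ∧ ∀ y : M, p * y = y → y * q = y → ∃ c : ℂ, y = c • x := by
  have hps := hp.1.isSelfAdjoint.star_eq
  have hqs := hq.1.isSelfAdjoint.star_eq
  have hqx : q * star x = star x := by simpa [hqs] using congrArg star hxq
  have hxp : star x * p = star x := by simpa [hps] using congrArg star hpx
  obtain ⟨a, ha⟩ := hq.exists_smul hτ (z := star x * x) (by rw [← mul_assoc, hqx])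
    (by rw [mul_assoc, hxq])
  obtain ⟨b, hb⟩ := hp.exists_smul hτ (z := x * star x) (by rw [← mul_assoc, hpx])
    (by rw [mul_assoc, hxp])
  have ha0 : a ≠ 0 := by
    rintro rfl
    rw [zero_smul, CStarRing.star_mul_self_eq_zero_iff] at ha
    exact hx ha
  have hab : a = b := by
    have h1 : a • x = b • x := by
      calc a • x = x * (star x * x) := by rw [ha, mul_smul_comm, hxq]
        _ = b • x := by rw [← mul_assoc, hb, smul_mul_assoc, hpx]
    exact smul_left_injective ℂ hx h1
  refine ⟨?_, fun y hpy hyq => ?_⟩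
  · have := hτ.tracial (star x) x
    rw [ha, hb, map_smul, map_smul, hab] at this
    exact ((smul_right_injective ℂ (hab ▸ ha0)) this).symm
  · obtain ⟨c, hc⟩ := hp.exists_smul hτ (z := y * star x) (by rw [← mul_assoc, hpy])
      (by rw [mul_assoc, hxp])
    refine ⟨c / a, ?_⟩
    have h1 : a • y = c • x := by
      calc a • y = y * (star x * x) := by rw [ha, mul_smul_comm, hyq]
        _ = c • x := by rw [← mul_assoc, hc, smul_mul_assoc, hpx]
    rw [div_eq_inv_mul, mul_smul, ← h1, inv_smul_smul₀ ha0]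

/-! ### Atomic algebras -/

theorem isCompactOperator_of_forall_mem {H : Type*} [NormedAddCommGroup H]
    [InnerProductSpace ℂ H] {T : H →L[ℂ] H} {W : Submodule ℂ H} [FiniteDimensional ℂ W]
    (hT : ∀ ξ, T ξ ∈ W) : IsCompactOperator T := by
  have : ProperSpace W := FiniteDimensional.proper ℂ W
  exact (isCompactOperator_of_locallyCompactSpace_rng W.subtypeL).comp_clm (T.codRestrict W hT)

theorem isStarProjection_sum {S : Set M} (hS : ∀ e ∈ S, IsStarProjection e)
    (hpw : S.Pairwise fun e f => e * f = 0) (F : Finset S) :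
    IsStarProjection (∑ e ∈ F, (e : M)) := by
  classical
  induction F using Finset.induction_on with
  | empty => simp [IsStarProjection.zero]
  | insert e F he ih =>
    rw [Finset.sum_insert he]
    refine (hS e e.2).add ih ?_
    rw [Finset.mul_sum]
    exact Finset.sum_eq_zero fun f hf =>
      hpw e.2 f.2 fun h => he (by rwa [Subtype.ext h])

/-- In an atomic algebra, `1` is the strong sum of a family of orthogonal minimal projections. -/
theorem IsAtomicVN.exists_family (hM : M.IsAtomicVN) :
    ∃ S : Set M, (∀ e ∈ S, M.IsMinimalProjection e) ∧ (S.Pairwise fun e f => e * f = 0) ∧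
      ∀ ζ : K, Tendsto (fun F : Finset S => ((∑ e ∈ F, (e : M) : M) : K →L[ℂ] K) ζ) atTop
        (𝓝 ζ) := by
  classical
  obtain ⟨S, hS⟩ := zorn_subset
    {S : Set M | (∀ e ∈ S, M.IsMinimalProjection e) ∧ S.Pairwise fun e f => e * f = 0} (by
      intro c hc hchain
      refine ⟨⋃₀ c, ⟨?_, ?_⟩, fun s hs => Set.subset_sUnion_of_mem hs⟩
      · rintro e ⟨s, hs, he⟩
        exact (hc hs).1 e he
      · exact (Set.pairwise_sUnion hchain.directedOn).2 fun s hs => (hc hs).2)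
  have hproj : ∀ e ∈ S, IsStarProjection e := fun e he => (hS.prop.1 e he).1
  obtain ⟨q, hq, hle, hlim⟩ := exists_tendsto_projection
    (fun F : Finset S => isStarProjection_sum hproj hS.prop.2 F) (by
      intro F G hFG
      exact Finset.sum_le_sum_of_subset_of_nonneg hFG fun e _ _ => (hproj e e.2).nonneg)
  refine ⟨S, hS.prop.1, hS.prop.2, ?_⟩
  suffices q = 1 by simpa [this] using hlim
  by_contra hq1
  -- A minimal projection below `1 - q` could be added to the maximal family.
  obtain ⟨f, hf, hf1⟩ := hM (1 - q) hq.one_sub (sub_ne_zero.2 (Ne.symm hq1))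
  have hfq : f * q = 0 := by
    rw [mul_sub, mul_one, sub_eq_self] at hf1
    exact hf1
  have horth : ∀ e ∈ S, f * e = 0 := by
    intro e he
    have h1 : q * e = e := ((hproj e he).le_iff_mul_eq_right hq).1 (by
      simpa using hle {⟨e, he⟩})
    rw [← h1, ← mul_assoc, hfq, zero_mul]
  have hfS : f ∈ S := by
    refine hS.le_of_ge (y := insert f S) ⟨?_, ?_⟩ (Set.subset_insert f S) (Set.mem_insert f S)
    · rintro e (rfl | he)
      · exact hf
      · exact hS.prop.1 e he
    · refine hS.prop.2.insert fun e he _ => ⟨horth e he, ?_⟩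
      simpa [hf.1.isSelfAdjoint.star_eq, (hproj e he).isSelfAdjoint.star_eq] using
        congrArg star (horth e he)
  exact hf.2.1 (by rw [← hf.1.isIdempotentElem.eq, horth f hfS])

/-- In an atomic finite algebra, `pL²M` is finite-dimensional for a minimal projection `p`: it is
spanned by the one-dimensional spaces `pMe`, where `e` runs over those members of a maximal
orthogonal family of minimal projections for which `pMe ≠ 0`; these have the same trace as `p`, so
there are finitely many of them. -/
theorem IsMinimalProjection.isCompactOperator (hτ : M.IsFaithfulNormalTracialState τ)
    {S : Set M} (hS : ∀ e ∈ S, M.IsMinimalProjection e) (hpw : S.Pairwise fun e f => e * f = 0)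
    (hlim : ∀ ζ : K, Tendsto (fun F : Finset S => ((∑ e ∈ F, (e : M) : M) : K →L[ℂ] K) ζ) atTop
      (𝓝 ζ)) {p : M} (hp : M.IsMinimalProjection p) :
    IsCompactOperator (standardRep τ p) := by
  classical
  have hproj : ∀ e ∈ S, IsStarProjection e := fun e he => (hS e he).1
  have htot : ∀ x : M, (∀ e ∈ S, x * e = 0) → x = 0 := by
    intro x hx
    refine Subtype.ext (ContinuousLinearMap.ext fun ζ => ?_)
    refine tendsto_nhds_unique (((x : K →L[ℂ] K).continuous.tendsto _).comp (hlim ζ)) ?_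
    refine tendsto_const_nhds.congr fun F => ?_
    have h1 : x * ∑ e ∈ F, (e : M) = 0 := by
      rw [Finset.mul_sum]
      exact Finset.sum_eq_zero fun e _ => hx e e.2
    exact (DFunLike.congr_fun (congrArg Subtype.val h1) ζ).symm
  -- The members of the family that contribute to `pM`.
  set J : Set S := {e | ∃ x : M, p * x * e ≠ 0} with hJ
  have htr : ∀ e ∈ J, (τ (e : M)).re = (τ p).re := by
    rintro e ⟨x, hx⟩
    rw [((hp.corner hτ (hS e e.2) (x := p * x * e)
      (by rw [← mul_assoc, ← mul_assoc, hp.1.isIdempotentElem.eq])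
      (by rw [mul_assoc, (hproj e e.2).isIdempotentElem.eq]) hx).1)]
  have hJfin : J.Finite := by
    by_contra hinf
    have hpos := trace_re_pos hτ hp.1 hp.2.1
    obtain ⟨n, hn⟩ := exists_nat_gt (1 / (τ p).re)
    obtain ⟨F, hFJ, hFn⟩ := Set.Infinite.exists_subset_card_eq hinf n
    have h1 := trace_re_le_one hτ (isStarProjection_sum hproj hpw F)
    rw [map_sum, Complex.re_sum, Finset.sum_congr rfl fun e he => htr e (hFJ he),
      Finset.sum_const, hFn, nsmul_eq_mul] at h1
    rw [div_lt_iff₀ hpos] at hn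
    linarith
  choose! v hv using fun (e : S) (he : e ∈ J) => he
  set W : Submodule ℂ (L2 τ) :=
    Submodule.span ℂ ((fun e : S => hat τ (p * v e * e)) '' J) with hW
  have : FiniteDimensional ℂ W := FiniteDimensional.span_of_finite ℂ (hJfin.image _)
  have hmem : ∀ x : M, hat τ (p * x) ∈ W := by
    intro x
    have hsum : p * x = ∑ e ∈ hJfin.toFinset, p * x * e := by
      rw [← sub_eq_zero]
      refine htot _ fun f hf => ?_
      rw [sub_mul, Finset.sum_mul]
      by_cases hfJ : (⟨f, hf⟩ : S) ∈ J
      · rw [Finset.sum_eq_single_of_mem (⟨f, hf⟩ : S) (hJfin.mem_toFinset.2 hfJ), mul_assoc (p * x),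
          (hproj f hf).isIdempotentElem.eq, sub_self]
        intro e _ hne
        rw [mul_assoc, hpw e.2 hf fun h => hne (Subtype.ext h), mul_zero]
      · rw [Finset.sum_eq_zero, sub_zero]
        · by_contra h
          exact hfJ ⟨x, h⟩
        · intro e he
          rw [mul_assoc, hpw e.2 hf, mul_zero]
          rintro rfl
          exact hfJ (hJfin.mem_toFinset.1 he)
    rw [hsum, hat_sum]
    refine Submodule.sum_mem _ fun e he => ?_
    rw [hJfin.mem_toFinset] at he
    have hpp : ∀ x : M, p * (p * x * e) = p * x * e := fun x => by
      rw [← mul_assoc, ← mul_assoc, hp.1.isIdempotentElem.eq]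
    have hee : ∀ x : M, p * x * e * e = p * x * e := fun x => by
      rw [mul_assoc, (hproj e e.2).isIdempotentElem.eq]
    obtain ⟨c, hc⟩ := (hp.corner hτ (hS e e.2) (hpp _) (hee _) (hv e he)).2 _ (hpp x) (hee x)
    rw [hc, hat_smul]
    exact Submodule.smul_mem _ _ (Submodule.subset_span ⟨e, he, rfl⟩)
  have hrange : ∀ ξ, standardRep τ p ξ ∈ W := by
    have hcl : IsClosed {ξ | standardRep τ p ξ ∈ W} :=
      W.closed_of_finiteDimensional.preimage (standardRep τ p).continuous
    intro ξ
    refine (denseRange_hat (τ := τ)).induction_on ξ hcl fun x => ?_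
    rw [standardRep_hat]
    exact hmem x
  exact isCompactOperator_of_forall_mem hrange

/-- A smooth operator `T` is the norm limit of the operators `q T`, where `q` runs over the finite
sums of orthogonal minimal projections; these are compact when `M` is finite and atomic. -/
theorem IsAtomicVN.isCompactOperator (hτ : M.IsFaithfulNormalTracialState τ)
    (hM : M.IsAtomicVN) {T : L2 τ →L[ℂ] L2 τ} (hT : T ∈ M.smoothPart (standardRep τ)) :
    IsCompactOperator T := by
  classical
  obtain ⟨S, hS, hpw, hlim⟩ := hM.exists_family
  have hproj : ∀ e ∈ S, IsStarProjection e := fun e he => (hS e he).1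
  have hsum := isStarProjection_sum hproj hpw
  have hstrong : Tendsto (fun F : Finset S => ∑ e ∈ F, (e : M)) atTop
      (@nhdsWithin M M.strongStarTopology 1 {x | ‖x‖ ≤ 1}) := by
    let := M.strongStarTopology
    refine tendsto_nhdsWithin_iff.2 ⟨?_, Eventually.of_forall fun F =>
      IsStarProjection.norm_le _ (hsum F)⟩
    rw [nhds_induced, tendsto_comap_iff, nhds_prod_eq]
    refine Tendsto.prodMk (tendsto_pi_nhds.2 fun ζ => hlim ζ) (tendsto_pi_nhds.2 fun ζ => ?_)
    have hstar : ∀ F : Finset S, star ((∑ e ∈ F, (e : M) : M) : K →L[ℂ] K) =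
        ((∑ e ∈ F, (e : M) : M) : K →L[ℂ] K) := fun F =>
      (isStarProjection_coe.2 (hsum F)).isSelfAdjoint.star_eq
    have h1 : (star ((1 : M) : K →L[ℂ] K)) ζ = ζ := DFunLike.congr_fun (star_one (K →L[ℂ] K)) ζ
    rw [h1]
    exact (hlim ζ).congr fun F => (DFunLike.congr_fun (hstar F) ζ).symm
  have h1 : ‖(1 : M)‖ ≤ 1 := IsStarProjection.norm_le _ (IsStarProjection.one M)
  have hconv := Tendsto.comp (hT.1 1 h1) hstrong
  simp only [map_one, one_mul] at hconv
  refine isCompactOperator_of_tendsto hconv (Eventually.of_forall fun F => ?_)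
  simp only [Function.comp]
  rw [map_sum, Finset.sum_mul]
  refine Finset.sum_induction (fun e : S => standardRep τ e * T)
    (fun A : L2 τ →L[ℂ] L2 τ => IsCompactOperator A) (fun A B hA hB => hA.add hB)
    isCompactOperator_zero fun e _ => ?_
  exact ((hS e e.2).isCompactOperator hτ hS hpw hlim).comp_clm T

/-! ### Diffuse algebras: a flow of projections -/

theorem trace_re_mono {p q : M} (h : p ≤ q) : (τ p).re ≤ (τ q).re :=
  (Complex.le_def.1 (OrderHomClass.mono τ h)).1

theorem trace_eq_ofReal_re {p : M} (hp : IsStarProjection p) : τ p = ((τ p).re : ℂ) := by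
  rw [norm_hat_sq_of_isStarProjection hp, Complex.ofReal_re]

/-- The supremum of a chain of projections, with the normality of the trace. -/
theorem exists_sup_of_isChain (hτ : M.IsFaithfulNormalTracialState τ) {L : Set M}
    (hL : ∀ e ∈ L, IsStarProjection e) (hchain : IsChain (· ≤ ·) L) (hne : L.Nonempty) :
    ∃ q : M, IsStarProjection q ∧ (∀ e ∈ L, e ≤ q) ∧
      (∀ f : M, IsStarProjection f → (∀ e ∈ L, e ≤ f) → q ≤ f) ∧
      ∀ t : ℝ, (∀ e ∈ L, (τ e).re ≤ t) → (τ q).re ≤ t := by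
  have : Nonempty L := hne.to_subtype
  have : IsDirectedOrder L := ⟨fun a b => by
    rcases hchain.total a.2 b.2 with h | h
    · exact ⟨b, h, le_rfl⟩
    · exact ⟨a, le_rfl, h⟩⟩
  have hL' : ∀ e : L, IsStarProjection (e : M) := fun e => hL e e.2
  obtain ⟨q, hq, hle, hlim⟩ := exists_tendsto_projection hL' (fun a b h => h)
  refine ⟨q, hq, fun e he => hle ⟨e, he⟩, fun f hf hfe => ?_, fun t ht => ?_⟩
  · refine (hq.le_iff_mul_eq_right hf).2 (Subtype.ext (ContinuousLinearMap.ext fun ζ => ?_))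
    have h1 := ((f : K →L[ℂ] K).continuous.tendsto _).comp (hlim ζ)
    refine tendsto_nhds_unique h1 ((hlim ζ).congr fun e => ?_)
    have h2 : f * (e : M) = e := ((hL' e).le_iff_mul_eq_right hf).1 (hfe e e.2)
    exact (DFunLike.congr_fun (congrArg Subtype.val h2) ζ).symm
  · exact le_of_tendsto (tendsto_trace_re hτ hL' hq hlim) (Eventually.of_forall fun e => ht e e.2)

/-- The infimum of a chain of projections, obtained from `exists_sup_of_isChain` by taking
complements. -/
theorem exists_inf_of_isChain (hτ : M.IsFaithfulNormalTracialState τ) {L : Set M}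
    (hL : ∀ e ∈ L, IsStarProjection e) (hchain : IsChain (· ≤ ·) L) (hne : L.Nonempty) :
    ∃ q : M, IsStarProjection q ∧ (∀ e ∈ L, q ≤ e) ∧
      (∀ f : M, IsStarProjection f → (∀ e ∈ L, f ≤ e) → f ≤ q) ∧
      ∀ t : ℝ, (∀ e ∈ L, t ≤ (τ e).re) → t ≤ (τ q).re := by
  have htr : ∀ e : M, (τ (1 - e)).re = 1 - (τ e).re := fun e => by
    rw [map_sub, hτ.map_one, Complex.sub_re, Complex.one_re]
  obtain ⟨q, hq, h1, h2, h3⟩ := exists_sup_of_isChain hτ (L := (fun e => 1 - e) '' L)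
    (by rintro _ ⟨e, he, rfl⟩; exact (hL e he).one_sub)
    (by
      rintro _ ⟨e, he, rfl⟩ _ ⟨f, hf, rfl⟩ -
      rcases hchain.total he hf with h | h
      · exact Or.inr (sub_le_sub_left h 1)
      · exact Or.inl (sub_le_sub_left h 1))
    (hne.image _)
  refine ⟨1 - q, hq.one_sub, fun e he => sub_le_comm.1 (h1 _ ⟨e, he, rfl⟩), fun f hf hfe => ?_,
    fun t ht => ?_⟩
  · refine le_sub_comm.1 (h2 _ hf.one_sub ?_)
    rintro _ ⟨e, he, rfl⟩
    exact sub_le_sub_left (hfe e he) 1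
  · rw [htr]
    have := h3 (1 - t) (by
      rintro _ ⟨e, he, rfl⟩
      rw [htr]
      linarith [ht e he])
    linarith

/-- In a diffuse algebra, a maximal chain of projections takes every trace value in `[0, 1]`: a gap
of the values would be bridged by splitting the difference of the projections at its ends. -/
theorem IsDiffuse.exists_flow (hτ : M.IsFaithfulNormalTracialState τ) (hM : M.IsDiffuse) :
    ∃ e : ℝ → M, (∀ t, IsStarProjection (e t)) ∧ Monotone e ∧
      ∀ t ∈ Set.Icc (0 : ℝ) 1, τ (e t) = t := by
  obtain ⟨C, hC⟩ := zorn_subset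
    {C : Set M | (∀ e ∈ C, IsStarProjection e) ∧ IsChain (· ≤ ·) C} (by
      intro c hc hchain
      refine ⟨⋃₀ c, ⟨?_, ?_⟩, fun s hs => Set.subset_sUnion_of_mem hs⟩
      · rintro e ⟨s, hs, he⟩
        exact (hc hs).1 e he
      · exact (Set.pairwise_sUnion hchain.directedOn).2 fun s hs => (hc hs).2)
  have hproj := hC.prop.1
  have hch := hC.prop.2
  have hins : ∀ f : M, IsStarProjection f → (∀ e ∈ C, e ≤ f ∨ f ≤ e) → f ∈ C := by
    intro f hf h
    refine hC.le_of_ge (y := insert f C) ⟨?_, ?_⟩ (Set.subset_insert f C) (Set.mem_insert f C)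
    · rintro e (rfl | he)
      · exact hf
      · exact hproj e he
    · exact hch.insert fun e he _ => (h e he).symm
  have h0C : (0 : M) ∈ C := hins 0 (IsStarProjection.zero M) fun e he =>
    Or.inr (hproj e he).nonneg
  have h1C : (1 : M) ∈ C := hins 1 (IsStarProjection.one M) fun e he =>
    Or.inl (hproj e he).le_one
  have key : ∀ t ∈ Set.Icc (0 : ℝ) 1, ∃ e ∈ C, (τ e).re = t := by
    intro t ht
    obtain ⟨q, hq, hq1, hq2, hq3⟩ := exists_sup_of_isChain hτ
      (L := {e | e ∈ C ∧ (τ e).re ≤ t}) (fun e he => hproj e he.1)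
      (hch.mono fun e he => he.1) ⟨0, h0C, by simpa using ht.1⟩
    obtain ⟨r, hr, hr1, hr2, hr3⟩ := exists_inf_of_isChain hτ
      (L := {e | e ∈ C ∧ t ≤ (τ e).re}) (fun e he => hproj e he.1)
      (hch.mono fun e he => he.1) ⟨1, h1C, by simpa [hτ.map_one] using ht.2⟩
    have hqt : (τ q).re ≤ t := hq3 t fun e he => he.2
    have hrt : t ≤ (τ r).re := hr3 t fun e he => he.2
    have hle : ∀ f ∈ C, (τ f).re < t → f ≤ r := fun f hf hft =>
      hr2 f (hproj f hf) fun e he => (hch.total hf he.1).resolve_right fun h =>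
        absurd (trace_re_mono (τ := τ) h) (not_le.2 (hft.trans_le he.2))
    have hge : ∀ f ∈ C, t < (τ f).re → q ≤ f := fun f hf hft =>
      hq2 f (hproj f hf) fun e he => (hch.total he.1 hf).resolve_right fun h =>
        absurd (trace_re_mono (τ := τ) h) (not_le.2 (he.2.trans_lt hft))
    have hqC : q ∈ C := hins q hq fun f hf => by
      rcases le_or_gt (τ f).re t with h | h
      · exact Or.inl (hq1 f ⟨hf, h⟩)
      · exact Or.inr (hge f hf h)
    have hrC : r ∈ C := hins r hr fun f hf => by
      rcases lt_or_ge (τ f).re t with h | h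
      · exact Or.inl (hle f hf h)
      · exact Or.inr (hr1 f ⟨hf, h⟩)
    by_contra! hno
    have hqt' : (τ q).re < t := lt_of_le_of_ne hqt (hno q hqC)
    have hrt' : t < (τ r).re := lt_of_le_of_ne hrt (hno r hrC).symm
    -- The values of the trace on `C` skip the interval between `τ q` and `τ r`.
    have hqr : q ≤ r := hle q hqC hqt'
    have hd : IsStarProjection (r - q) := (hq.le_iff_sub hr).1 hqr
    have hd0 : r - q ≠ 0 := by
      rw [sub_ne_zero]
      rintro rfl
      linarith
    obtain ⟨g, hg, hgd, hg0, hg1⟩ : ∃ g : M, IsStarProjection g ∧ g * (r - q) = g ∧ g ≠ 0 ∧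
        g ≠ r - q := by
      have := hM (r - q)
      simp only [IsMinimalProjection, not_and, not_forall, not_or] at this
      obtain ⟨g, hg, hgd, h1, h2⟩ := this hd hd0
      exact ⟨g, hg, hgd, h1, h2⟩
    have hgle : g ≤ r - q := (hg.le_iff_mul_eq_left hd).2 hgd
    have hqg : q * g = 0 := by
      have h1 := (hg.le_iff_mul_eq_right hd).1 hgle
      rw [← h1, ← mul_assoc, mul_sub, (hq.le_iff_mul_eq_left hr).1 hqr,
        hq.isIdempotentElem.eq, sub_self, zero_mul]
    have hh : IsStarProjection (q + g) := hq.add hg hqg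
    have hhr : q + g ≤ r := le_sub_iff_add_le'.1 hgle
    have hhC : q + g ∈ C := hins _ hh fun f hf => by
      rcases le_or_gt (τ f).re t with h | h
      · exact Or.inl ((hq1 f ⟨hf, h⟩).trans (le_add_of_nonneg_right hg.nonneg))
      · exact Or.inr (hhr.trans (hr1 f ⟨hf, h.le⟩))
    rcases le_or_gt (τ (q + g)).re t with h | h
    · have h1 := hq1 _ ⟨hhC, h⟩
      exact hg0 (le_antisymm (by simpa using h1) hg.nonneg)
    · have h1 := hr1 _ ⟨hhC, h.le⟩
      exact hg1 (le_antisymm hgle (sub_le_iff_le_add'.2 h1))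
  -- Outside `[0, 1]` the flow is constant, which makes it monotone on the whole line.
  choose! E hEC hEt using key
  have hclamp : ∀ t : ℝ, (Set.projIcc (0 : ℝ) 1 zero_le_one t : ℝ) ∈ Set.Icc (0 : ℝ) 1 := fun t =>
    (Set.projIcc (0 : ℝ) 1 zero_le_one t).2
  refine ⟨fun t => E (Set.projIcc (0 : ℝ) 1 zero_le_one t), fun t => hproj _ (hEC _ (hclamp t)),
    fun s t hst => ?_, fun t ht => ?_⟩
  · have hst' : (Set.projIcc (0 : ℝ) 1 zero_le_one s : ℝ) ≤ Set.projIcc (0 : ℝ) 1 zero_le_one t :=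
      Set.monotone_projIcc _ hst
    rcases hch.total (hEC _ (hclamp s)) (hEC _ (hclamp t)) with h | h
    · exact h
    · have h1 := trace_re_mono (τ := τ) h
      rw [hEt _ (hclamp s), hEt _ (hclamp t)] at h1
      dsimp only
      rw [le_antisymm hst' h1]
  · dsimp only
    rw [trace_eq_ofReal_re (hproj _ (hEC _ (hclamp t))), hEt _ (hclamp t),
      Set.projIcc_of_mem _ ht]

/-! ### Rademacher sequences -/

/-- The unital *-homomorphism `f ↦ ∑ₖ f(k) dₖ` given by a finite partition of unity into
projections `d₀, …, dₙ₋₁`. The functions `f` are indexed by `ℕ` and the values `f(k)` with `k ≥ n`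
are ignored, so that one type of functions serves all partitions. -/
noncomputable def stepHom (n : ℕ) (d : ℕ → M) (hd : ∀ k < n, IsStarProjection (d k))
    (horth : ∀ k < n, ∀ l < n, k ≠ l → d k * d l = 0)
    (hsum : ∑ k ∈ Finset.range n, d k = 1) : (ℕ → ℂ) →⋆ₐ[ℂ] M where
  toFun f := ∑ k ∈ Finset.range n, f k • d k
  map_one' := by simpa using hsum
  map_zero' := by simp
  map_add' f g := by simp [add_smul, Finset.sum_add_distrib]
  map_mul' f g := by
    rw [Finset.sum_mul_sum]
    refine Finset.sum_congr rfl fun k hk => ?_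
    rw [Finset.sum_eq_single_of_mem k hk]
    · rw [smul_mul_smul_comm, (hd k (Finset.mem_range.1 hk)).isIdempotentElem.eq, Pi.mul_apply]
    · intro l hl hlk
      rw [smul_mul_smul_comm, horth k (Finset.mem_range.1 hk) l (Finset.mem_range.1 hl) hlk.symm,
        smul_zero]
  commutes' c := by
    simp only [Pi.algebraMap_apply, Algebra.algebraMap_self, RingHom.id_apply]
    rw [← Finset.smul_sum, hsum, Algebra.algebraMap_eq_smul_one]
  map_star' f := by
    rw [star_sum]
    refine Finset.sum_congr rfl fun k hk => ?_
    rw [star_smul, (hd k (Finset.mem_range.1 hk)).isSelfAdjoint.star_eq, Pi.star_apply]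

theorem sum_range_two_mul {β : Type*} [AddCommMonoid β] (g : ℕ → β) (n : ℕ) :
    ∑ k ∈ Finset.range (2 * n), g k = ∑ k ∈ Finset.range n, (g (2 * k) + g (2 * k + 1)) := by
  induction n with
  | zero => simp
  | succ n ih =>
    rw [show 2 * (n + 1) = 2 * n + 1 + 1 by ring, Finset.sum_range_succ, Finset.sum_range_succ, ih,
      Finset.sum_range_succ, add_assoc]

/-- A diffuse algebra contains a sequence of Rademacher variables: selfadjoint unitaries `rₙ` in an
increasing sequence of commutative *-subalgebras `Dₙ` such that `rₙ ∈ Dₙ₊₁` is independent of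
`Dₙ`. They are the Rademacher functions of a flow of projections, and `Dₙ` is the algebra of step
functions on the dyadic intervals of length `2⁻ⁿ`. -/
theorem IsDiffuse.exists_rademacher (hτ : M.IsFaithfulNormalTracialState τ) (hM : M.IsDiffuse) :
    ∃ (D : ℕ → StarSubalgebra ℂ M) (r : ℕ → M), Monotone D ∧
      (∀ n, ∀ x ∈ D n, ∀ y ∈ D n, x * y = y * x) ∧
      ∀ n, r n ∈ D (n + 1) ∧ star (r n) = r n ∧ r n * r n = 1 ∧
        ∀ y ∈ D n, τ (y * r n) = 0 := by
  obtain ⟨e, he, hmono, htr⟩ := hM.exists_flow hτ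
  have hee : ∀ {s t : ℝ}, s ≤ t → e s * e t = e s ∧ e t * e s = e s := fun {s t} hst =>
    ⟨((he s).le_iff_mul_eq_left (he t)).1 (hmono hst),
      ((he s).le_iff_mul_eq_right (he t)).1 (hmono hst)⟩
  have he0 : e 0 = 0 := eq_zero_of_trace_eq_zero hτ (he 0).nonneg (by
    rw [htr 0 (by simp), Complex.ofReal_zero])
  have he1 : e 1 = 1 := (sub_eq_zero.1 (eq_zero_of_trace_eq_zero hτ (he 1).one_sub_nonneg (by
    rw [map_sub, htr 1 (by simp), hτ.map_one, Complex.ofReal_one, sub_self]))).symm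
  -- `d n k` is the indicator function of the `k`-th dyadic interval of length `2⁻ⁿ`.
  set t : ℕ → ℕ → ℝ := fun n k => (k : ℝ) / 2 ^ n with ht
  have htmono : ∀ n, Monotone (t n) := fun n k l hkl => by
    simp only [ht]
    gcongr
  have ht2 : ∀ n k, t (n + 1) (2 * k) = t n k := fun n k => by
    simp only [ht, pow_succ']
    push_cast
    field_simp
  set d : ℕ → ℕ → M := fun n k => e (t n (k + 1)) - e (t n k) with hd
  have hdproj : ∀ n k, IsStarProjection (d n k) := fun n k =>
    (he _).sub_of_mul_eq_left (he _) (hee (htmono n k.le_succ)).1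
  have hdlt : ∀ n k l, k < l → d n k * d n l = 0 ∧ d n l * d n k = 0 := by
    intro n k l hkl
    have h1 : t n (k + 1) ≤ t n l := htmono n hkl
    have h2 : t n l ≤ t n (l + 1) := htmono n l.le_succ
    have h3 : t n k ≤ t n (k + 1) := htmono n k.le_succ
    simp only [hd, mul_sub, sub_mul, hee h1, hee (h1.trans h2), hee (h3.trans h1),
      hee (h3.trans (h1.trans h2)), sub_self, and_self]
  have hdorth : ∀ n k l, k ≠ l → d n k * d n l = 0 := fun n k l hkl => by
    rcases lt_or_gt_of_ne hkl with h | h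
    · exact (hdlt n k l h).1
    · exact (hdlt n l k h).2
  have hdsum : ∀ n, ∑ k ∈ Finset.range (2 ^ n), d n k = 1 := fun n => by
    rw [Finset.sum_range_sub fun k => e (t n k)]
    simp [ht, he0, he1]
  have hdtr : ∀ n, ∀ k < 2 ^ n, τ (d n k) = (((2 : ℝ) ^ n)⁻¹ : ℝ) := by
    intro n k hk
    have hmem : ∀ k ≤ 2 ^ n, t n k ∈ Set.Icc (0 : ℝ) 1 := fun k hk =>
      ⟨by positivity, div_le_one_of_le₀ (by exact_mod_cast hk) (by positivity)⟩
    rw [hd, map_sub, htr _ (hmem _ hk), htr _ (hmem _ hk.le), ← Complex.ofReal_sub]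
    congr 1
    simp only [ht]
    push_cast
    ring
  have hdsplit : ∀ n k, d n k = d (n + 1) (2 * k) + d (n + 1) (2 * k + 1) := fun n k => by
    have h1 : t (n + 1) (2 * k + 1 + 1) = t n (k + 1) := ht2 n (k + 1)
    simp only [hd, h1, ht2]
    abel
  set S : ℕ → (ℕ → ℂ) →⋆ₐ[ℂ] M := fun n => stepHom (2 ^ n) (d n) (fun k _ => hdproj n k)
    (fun k _ l _ => hdorth n k l) (hdsum n) with hS
  have hSdef : ∀ n f, S n f = ∑ k ∈ Finset.range (2 ^ n), f k • d n k := fun n f => rfl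
  have hSsucc : ∀ n f, S n f = S (n + 1) fun k => f (k / 2) := fun n f => by
    rw [hSdef, hSdef, pow_succ', sum_range_two_mul]
    refine Finset.sum_congr rfl fun k _ => ?_
    rw [hdsplit, smul_add, Nat.mul_div_cancel_left k two_pos,
      show (2 * k + 1) / 2 = k by omega]
  refine ⟨fun n => (S n).range, fun n => S (n + 1) fun k => (-1) ^ k, ?_, ?_, fun n =>
    ⟨⟨_, rfl⟩, ?_, ?_, ?_⟩⟩
  · refine monotone_nat_of_le_succ fun n => ?_
    rintro _ ⟨f, rfl⟩
    exact ⟨_, (hSsucc n f).symm⟩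
  · rintro n _ ⟨f, rfl⟩ _ ⟨g, rfl⟩
    change S n f * S n g = S n g * S n f
    rw [← map_mul, mul_comm, map_mul]
  · rw [← map_star]
    congr 1
    ext k
    simp
  · rw [← map_mul, ← map_one (S (n + 1))]
    congr 1
    ext k
    simp [← mul_pow]
  · rintro _ ⟨f, rfl⟩
    change τ (S n f * _) = 0
    rw [hSsucc, ← map_mul, hSdef, map_sum, pow_succ']
    -- The two halves of each interval contribute opposite values.
    rw [Finset.sum_congr rfl (g := fun k => (f (k / 2) * (-1) ^ k) * (((2 : ℝ) ^ (n + 1))⁻¹ : ℝ)),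
      sum_range_two_mul]
    · refine Finset.sum_eq_zero fun k _ => ?_
      rw [Nat.mul_div_cancel_left k two_pos, show (2 * k + 1) / 2 = k by omega,
        pow_succ (-1 : ℂ), pow_mul, neg_one_sq, one_pow, mul_one, one_mul, mul_neg_one, neg_mul,
        add_neg_cancel]
    · intro k hk
      rw [map_smul, hdtr (n + 1) k (by rw [pow_succ']; exact Finset.mem_range.1 hk)]
      rfl

/-! ### Fourth moments -/

/-- The inequality `‖xy‖₂² ≤ ‖x‖ ‖x‖₂ ‖y‖₄²`, with `‖yy*‖₂` in the place of `‖y‖₄²`. -/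
theorem norm_hat_mul_sq_le (hτ : M.IsFaithfulNormalTracialState τ) (x y : M) :
    ‖hat τ (x * y)‖ ^ 2 ≤ ‖x‖ * ‖hat τ x‖ * ‖hat τ (y * star y)‖ := by
  have h1 : τ (star (x * y) * (x * y)) = τ (star (star x * x) * (y * star y)) := by
    rw [star_mul, star_mul, star_star, mul_assoc (star y), hτ.tracial (star y)]
    simp only [mul_assoc]
  calc ‖hat τ (x * y)‖ ^ 2 ≤ ‖τ (star (star x * x) * (y * star y))‖ := by
        rw [norm_hat_sq_re, h1]
        exact Complex.re_le_norm _
    _ ≤ ‖hat τ (star x * x)‖ * ‖hat τ (y * star y)‖ := norm_trace_mul_le _ _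
    _ ≤ ‖x‖ * ‖hat τ x‖ * ‖hat τ (y * star y)‖ := by
        gcongr
        exact (norm_hat_mul_le _ _).trans_eq (by rw [norm_star])

theorem mem_span_range_nat {E : Type*} [AddCommGroup E] [Module ℂ E] {ξ : ℕ → E} {ζ : E}
    (h : ζ ∈ Submodule.span ℂ (Set.range ξ)) :
    ∃ (N : ℕ) (c : ℕ → ℂ), ζ = ∑ i ∈ Finset.range N, c i • ξ i := by
  obtain ⟨c, rfl⟩ := Finsupp.mem_span_range_iff_exists_finsupp.1 h
  refine ⟨c.support.sup id + 1, c, ?_⟩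
  refine Finset.sum_subset (fun i hi => ?_) fun i _ hi => ?_
  · exact Finset.mem_range.2 (Nat.lt_succ_of_le (Finset.le_sup (f := id) hi))
  · simp [Finsupp.notMem_support_iff.1 hi]

theorem norm_add_sq_of_inner_eq_zero {E : Type*} [NormedAddCommGroup E] [InnerProductSpace ℂ E]
    {a b : E} (h : ⟪a, b⟫_ℂ = 0) : ‖a + b‖ ^ 2 = ‖a‖ ^ 2 + ‖b‖ ^ 2 := by
  rw [norm_add_sq (𝕜 := ℂ), h, map_zero, mul_zero, add_zero]

/-- The inductive step of the Khintchine inequality `‖y‖₄² ≤ 2‖y‖₂²`: adding an independent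
Rademacher variable. -/
theorem norm_hat_add_smul_mul_star_le (hτ : M.IsFaithfulNormalTracialState τ)
    {D : StarSubalgebra ℂ M} {r y : M} (hy : y ∈ D) (hr : star r = r) (hrr : r * r = 1)
    (hcomm : ∀ x ∈ D, r * x = x * r) (hind : ∀ x ∈ D, τ (x * r) = 0) (c : ℂ)
    (h4 : ‖hat τ (y * star y)‖ ≤ 2 * ‖hat τ y‖ ^ 2) :
    ‖hat τ ((y + c • r) * star (y + c • r))‖ ≤ 2 * ‖hat τ (y + c • r)‖ ^ 2 := by
  have hys : star y ∈ D := star_mem hy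
  set C := ‖c‖ with hC
  have hnr : ‖hat τ r‖ = 1 := by
    have h1 := norm_hat_sq_re (τ := τ) r
    rw [hr, hrr, hτ.map_one, Complex.one_re] at h1
    nlinarith [norm_nonneg (hat τ r)]
  have hnr' : ‖r‖ ≤ 1 := by
    have h1 := CStarRing.norm_star_mul_self (x := r)
    have h2 : ‖(1 : M)‖ ≤ 1 := IsStarProjection.norm_le _ (IsStarProjection.one M)
    rw [hr, hrr] at h1
    nlinarith [norm_nonneg r]
  have hY : ‖hat τ (y + c • r)‖ ^ 2 = ‖hat τ y‖ ^ 2 + C ^ 2 := by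
    rw [hat_add, norm_add_sq_of_inner_eq_zero, hat_smul, norm_smul, hnr, mul_one]
    rw [inner_hat_hat, mul_smul_comm, map_smul, hind _ hys, smul_zero]
  -- `yy*` turns into `u + wr` with `u` and `w` in `D`, and `u` and `wr` are orthogonal.
  set u : M := y * star y + ((C : ℂ) ^ 2) • 1 with hu
  set w : M := star c • y + c • star y with hw
  have huD : u ∈ D := add_mem (mul_mem hy hys) (D.smul_mem (one_mem D) _)
  have hwD : w ∈ D := add_mem (D.smul_mem hy _) (D.smul_mem hys _)
  have hexp : (y + c • r) * star (y + c • r) = u + w * r := by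
    have hcc : c * star c = (C : ℂ) ^ 2 := by
      rw [Complex.star_def, Complex.mul_conj, Complex.normSq_eq_norm_sq]
      norm_cast
    rw [star_add, star_smul, hr, add_mul, mul_add, mul_add, smul_mul_smul_comm, hrr, hcc,
      mul_smul_comm, smul_mul_assoc, hcomm _ hys, hu, hw, add_mul, smul_mul_assoc, smul_mul_assoc]
    abel
  have hun : ‖hat τ u‖ ≤ 2 * ‖hat τ y‖ ^ 2 + C ^ 2 := by
    rw [hu, hat_add, hat_smul]
    refine (norm_add_le _ _).trans (add_le_add h4 ?_)
    rw [norm_smul, norm_hat_one hτ, mul_one, norm_pow, Complex.norm_real, norm_norm]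
  have hwn : ‖hat τ (w * r)‖ ≤ 2 * (C * ‖hat τ y‖) := by
    calc ‖hat τ (w * r)‖ ≤ ‖hat τ w‖ * ‖r‖ := norm_hat_mul_le' hτ _ _
      _ ≤ ‖hat τ w‖ := mul_le_of_le_one_right (norm_nonneg _) hnr'
      _ ≤ 2 * (C * ‖hat τ y‖) := by
        rw [hw, hat_add, hat_smul, hat_smul]
        refine (norm_add_le _ _).trans_eq ?_
        rw [norm_smul, norm_smul, norm_hat_star hτ, norm_star]
        ring
  have horth : ⟪hat τ u, hat τ (w * r)⟫_ℂ = 0 := by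
    rw [inner_hat_hat, ← mul_assoc, hind _ (mul_mem (star_mem huD) hwD)]
  rw [hexp]
  refine le_of_sq_le_sq ?_ (by positivity)
  rw [hat_add, norm_add_sq_of_inner_eq_zero horth, hY]
  calc ‖hat τ u‖ ^ 2 + ‖hat τ (w * r)‖ ^ 2
      ≤ (2 * ‖hat τ y‖ ^ 2 + C ^ 2) ^ 2 + (2 * (C * ‖hat τ y‖)) ^ 2 := by gcongr
    _ ≤ (2 * (‖hat τ y‖ ^ 2 + C ^ 2)) ^ 2 := by nlinarith [sq_nonneg (C ^ 2)]

/-- In a diffuse algebra, the projection onto the span of a Rademacher sequence is smooth, and it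
is not compact. -/
theorem IsDiffuse.exists_mem_smoothPart (hτ : M.IsFaithfulNormalTracialState τ)
    (hM : M.IsDiffuse) : ∃ T ∈ M.smoothPart (standardRep τ), ¬ IsCompactOperator T := by
  obtain ⟨D, r, hD, hDc, hr⟩ := hM.exists_rademacher hτ
  have hrD : ∀ {i n}, i < n → r i ∈ D n := fun {i n} hin => hD hin (hr i).1
  have hsumD : ∀ (c : ℕ → ℂ) n, ∑ i ∈ Finset.range n, c i • r i ∈ D n := fun c n =>
    sum_mem fun i hi => (D n).smul_mem (hrD (Finset.mem_range.1 hi)) _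
  have hlt : ∀ i j, i < j → ⟪hat τ (r i), hat τ (r j)⟫_ℂ = 0 := fun i j hij => by
    rw [inner_hat_hat, (hr i).2.1, (hr j).2.2.2 _ (hrD hij)]
  have hort : Orthonormal ℂ fun n => hat τ (r n) := by
    refine ⟨fun n => ?_, fun i j hij => ?_⟩
    · have h1 := norm_hat_sq_re (τ := τ) (r n)
      rw [(hr n).2.1, (hr n).2.2.1, hτ.map_one, Complex.one_re] at h1
      nlinarith [norm_nonneg (hat τ (r n))]
    · rcases lt_or_gt_of_ne hij with h | h
      · exact hlt i j h
      · exact inner_eq_zero_symm.1 (hlt j i h)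
  refine ⟨_, spanProj_mem_smoothPart hτ zero_le_two ?_,
    not_isCompactOperator_spanProj_of_orthonormal hort⟩
  intro ζ hζ x
  obtain ⟨N, c, rfl⟩ := mem_span_range_nat hζ
  simp_rw [← hat_smul, ← hat_sum, standardRep_hat]
  have h4 : ∀ n, ‖hat τ ((∑ i ∈ Finset.range n, c i • r i) *
      star (∑ i ∈ Finset.range n, c i • r i))‖ ≤
        2 * ‖hat τ (∑ i ∈ Finset.range n, c i • r i)‖ ^ 2 := by
    intro n
    induction n with
    | zero => simp [hat_zero]
    | succ n ih =>
      rw [Finset.sum_range_succ]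
      exact norm_hat_add_smul_mul_star_le hτ (hsumD c n) (hr n).2.1 (hr n).2.2.1
        (fun x hx => hDc (n + 1) _ (hr n).1 _ (hD n.le_succ hx)) (hr n).2.2.2 (c n) ih
  refine (norm_hat_mul_sq_le hτ x _).trans ?_
  calc _ ≤ ‖x‖ * ‖hat τ x‖ * (2 * ‖hat τ (∑ i ∈ Finset.range N, c i • r i)‖ ^ 2) := by
        gcongr
        exact h4 N
    _ = _ := by ring

/-! ### Fourth moments of Gaussian variables -/

/-- The fourth moment of a real Gaussian variable, centred or not, is bounded by a universal
multiple of the square of its second moment. -/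
theorem exists_integral_pow_four_gaussianReal_le :
    ∃ κ : ℝ, 0 ≤ κ ∧ ∀ (a : ℝ) (v : ℝ≥0),
      ∫ x, x ^ 4 ∂(gaussianReal a v) ≤ κ * (∫ x, x ^ 2 ∂(gaussianReal a v)) ^ 2 := by
  set m₄ : ℝ := ∫ z, z ^ 4 ∂(gaussianReal 0 1) with hm₄
  have hm : 0 ≤ m₄ := integral_nonneg fun z => by positivity
  refine ⟨8 * (1 + m₄), by positivity, fun a v => ?_⟩
  have hsq : ∫ x, x ^ 2 ∂(gaussianReal a v) = a ^ 2 + v := by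
    have h := variance_eq_sub (memLp_id_gaussianReal (μ := a) (v := v) 2)
    rw [variance_id_gaussianReal] at h
    simp only [id, integral_id_gaussianReal, Pi.pow_apply] at h
    linarith
  -- Reduce to the standard Gaussian: `N(a, v)` is the law of `a + √v z`.
  have hmap : gaussianReal a v = (gaussianReal 0 1).map fun z => a + √v * z := by
    have h1 := gaussianReal_map_const_mul (μ := 0) (v := 1) √(v : ℝ)
    have h2 := gaussianReal_map_const_add (μ := √(v : ℝ) * 0)
      (v := NNReal.mk (√(v : ℝ) ^ 2) (sq_nonneg _) * 1) a
    rw [← h1, Measure.map_map (by fun_prop) (by fun_prop)] at h2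
    rw [show (fun z : ℝ => a + √v * z) = (fun z => a + z) ∘ fun z => √v * z from rfl, h2]
    congr 1
    · ring
    · ext
      simp
  have hint : Integrable (fun z : ℝ => z ^ 4) (gaussianReal 0 1) := by
    have h := (memLp_id_gaussianReal (μ := 0) (v := 1) 4).integrable_norm_pow (p := 4) (by norm_num)
    refine h.congr (Eventually.of_forall fun z => ?_)
    simp only [id, Real.norm_eq_abs]
    exact (by decide : Even 4).pow_abs z
  rw [hsq, hmap, integral_map (by fun_prop) (by fun_prop)]
  have hs : √(v : ℝ) ^ 4 = (v : ℝ) ^ 2 := by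
    calc √(v : ℝ) ^ 4 = (√(v : ℝ) ^ 2) ^ 2 := by ring
      _ = (v : ℝ) ^ 2 := by rw [Real.sq_sqrt v.coe_nonneg]
  calc ∫ z, (a + √v * z) ^ 4 ∂(gaussianReal 0 1)
      ≤ ∫ z, (8 * a ^ 4 + 8 * (v : ℝ) ^ 2 * z ^ 4) ∂(gaussianReal 0 1) := by
        refine integral_mono_of_nonneg (Eventually.of_forall fun z => by positivity)
          ((integrable_const _).add (hint.const_mul _)) (Eventually.of_forall fun z => ?_)
        have h := add_pow_le (abs_nonneg a) (abs_nonneg (√v * z)) 4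
        have h1 : (a + √v * z) ^ 4 ≤ (|a| + |√v * z|) ^ 4 := by
          rw [← (by decide : Even 4).pow_abs (a + √v * z)]
          gcongr
          exact abs_add_le _ _
        rw [(by decide : Even 4).pow_abs, (by decide : Even 4).pow_abs, mul_pow] at h
        simp only [Nat.reduceSub, hs] at h
        dsimp only
        linarith
    _ = 8 * a ^ 4 + 8 * (v : ℝ) ^ 2 * m₄ := by
        rw [integral_add (integrable_const _) (hint.const_mul _),
          integral_const_mul (8 * (v : ℝ) ^ 2), integral_const, probReal_univ, one_smul]
    _ ≤ 8 * (1 + m₄) * (a ^ 2 + v) ^ 2 := by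
        have h1 : a ^ 4 ≤ (a ^ 2 + v) ^ 2 := by
          nlinarith [mul_nonneg (sq_nonneg a) v.2, sq_nonneg (v : ℝ)]
        have h2 : (v : ℝ) ^ 2 ≤ (a ^ 2 + v) ^ 2 := by
          nlinarith [mul_nonneg (sq_nonneg a) v.2, sq_nonneg (a ^ 2)]
        have h3 := mul_le_mul_of_nonneg_right h2 hm
        nlinarith

theorem exists_integral_pow_four_le :
    ∃ κ : ℝ, 0 ≤ κ ∧ ∀ {X : Type*} [MeasurableSpace X] {μ : Measure X} {Y : X → ℝ},
      HasGaussianLaw Y μ → ∫ t, Y t ^ 4 ∂μ ≤ κ * (∫ t, Y t ^ 2 ∂μ) ^ 2 := by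
  obtain ⟨κ, hκ, h⟩ := exists_integral_pow_four_gaussianReal_le
  refine ⟨κ, hκ, fun {X} _ {μ Y} hY => ?_⟩
  have h1 := h (∫ t, Y t ∂μ) Var[Y; μ].toNNReal
  rwa [← hY.map_eq_gaussianReal, integral_map hY.aemeasurable (by fun_prop),
    integral_map hY.aemeasurable (by fun_prop)] at h1

/-- The fourth moment of a complex linear combination of independent Gaussian variables. -/
theorem exists_integral_norm_pow_four_le :
    ∃ κ : ℝ, 0 ≤ κ ∧ ∀ {X : Type*} [MeasurableSpace X] {μ : Measure X} {g : ℕ → X → ℝ},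
      iIndepFun g μ → (∀ n, HasGaussianLaw (g n) μ) → ∀ (N : ℕ) (c : ℕ → ℂ),
        Integrable (fun t => ‖∑ i ∈ Finset.range N, c i * (g i t : ℂ)‖ ^ 4) μ ∧
        ∫ t, ‖∑ i ∈ Finset.range N, c i * (g i t : ℂ)‖ ^ 4 ∂μ ≤
          κ * (∫ t, ‖∑ i ∈ Finset.range N, c i * (g i t : ℂ)‖ ^ 2 ∂μ) ^ 2 := by
  obtain ⟨κ, hκ, h⟩ := exists_integral_pow_four_le
  refine ⟨2 * κ, by positivity, fun {X} _ {μ g} hind hg N c => ?_⟩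
  have hjoint : HasGaussianLaw (fun t (i : Fin N) => g i t) μ :=
    iIndepFun.hasGaussianLaw (fun i => hg i) (hind.precomp Fin.val_injective)
  have hlin : ∀ a : ℕ → ℝ, HasGaussianLaw (fun t => ∑ i ∈ Finset.range N, a i * g i t) μ := by
    intro a
    have h1 := hjoint.map_fun (∑ i : Fin N, a i • ContinuousLinearMap.proj (R := ℝ)
      (φ := fun _ : Fin N => ℝ) i)
    refine h1.congr (Eventually.of_forall fun t => ?_)
    simp [Finset.sum_range]
  set A : X → ℝ := fun t => ∑ i ∈ Finset.range N, (c i).re * g i t with hA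
  set B : X → ℝ := fun t => ∑ i ∈ Finset.range N, (c i).im * g i t with hB
  have hAg : HasGaussianLaw A μ := hlin _
  have hBg : HasGaussianLaw B μ := hlin _
  have hsq : ∀ t, ‖∑ i ∈ Finset.range N, c i * (g i t : ℂ)‖ ^ 2 = A t ^ 2 + B t ^ 2 := by
    intro t
    rw [← Complex.normSq_eq_norm_sq, Complex.normSq_apply, Complex.re_sum, Complex.im_sum]
    simp [hA, hB, sq]
  have hint : ∀ {Y : X → ℝ}, HasGaussianLaw Y μ → ∀ k : ℕ,
      Integrable (fun t => Y t ^ (2 * k)) μ := by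
    intro Y hY k
    have := hY.isProbabilityMeasure
    rcases Nat.eq_zero_or_pos k with rfl | hk
    · simp
    have h1 := (hY.memLp (p := ((2 * k : ℕ) : ℝ≥0∞))
      (ENNReal.natCast_ne_top _)).integrable_norm_pow (by omega)
    refine h1.congr (Eventually.of_forall fun t => ?_)
    simp only [Real.norm_eq_abs]
    exact (even_two_mul k).pow_abs _
  have h4 : ∀ t, ‖∑ i ∈ Finset.range N, c i * (g i t : ℂ)‖ ^ 4 ≤ 2 * A t ^ 4 + 2 * B t ^ 4 := by
    intro t
    have h1 : ∀ z : ℝ, z ^ 4 = (z ^ 2) ^ 2 := fun z => by ring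
    rw [h1, hsq, h1 (A t), h1 (B t)]
    nlinarith [sq_nonneg (A t ^ 2 - B t ^ 2)]
  have hdom : Integrable (fun t => 2 * A t ^ 4 + 2 * B t ^ 4) μ :=
    ((hint hAg 2).const_mul 2).add ((hint hBg 2).const_mul 2)
  have hmeas : ∀ i, AEMeasurable (g i) μ := fun i => (hg i).aemeasurable
  refine ⟨hdom.mono' (by
      refine AEMeasurable.aestronglyMeasurable ?_
      fun_prop) (Eventually.of_forall fun t => ?_), ?_⟩
  · rw [Real.norm_of_nonneg (by positivity)]
    exact h4 t
  · simp_rw [hsq]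
    rw [integral_add (hint hAg 1) (hint hBg 1)]
    have hA2 : 0 ≤ ∫ t, A t ^ 2 ∂μ := integral_nonneg fun t => by positivity
    have hB2 : 0 ≤ ∫ t, B t ^ 2 ∂μ := integral_nonneg fun t => by positivity
    calc _ ≤ ∫ t, (2 * A t ^ 4 + 2 * B t ^ 4) ∂μ :=
          integral_mono_of_nonneg (Eventually.of_forall fun t => by positivity) hdom
            (Eventually.of_forall h4)
      _ = 2 * ∫ t, A t ^ 4 ∂μ + 2 * ∫ t, B t ^ 4 ∂μ := by
          rw [integral_add ((hint hAg 2).const_mul 2) ((hint hBg 2).const_mul 2),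
            integral_const_mul, integral_const_mul]
      _ ≤ 2 * (κ * (∫ t, A t ^ 2 ∂μ) ^ 2) + 2 * (κ * (∫ t, B t ^ 2 ∂μ) ^ 2) := by
          gcongr
          · exact h hAg
          · exact h hBg
      _ ≤ 2 * κ * (∫ t, A t ^ 2 ∂μ + ∫ t, B t ^ 2 ∂μ) ^ 2 := by
          nlinarith [mul_nonneg hκ (mul_nonneg hA2 hB2)]

/-! ### Abelian subalgebras as function algebras -/

namespace LInftyModel

variable {A : VonNeumannAlgebra K} {X : Type*} [MeasurableSpace X] {μ : Measure X}

theorem memLp_norm_sq (f : Lp ℂ ∞ μ) : MemLp (fun t => ((‖f t‖ ^ 2 : ℝ) : ℂ)) ∞ μ := by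
  have hf := Lp.memLp f
  refine memLp_top_of_bound (by
    have := hf.aestronglyMeasurable.norm.pow 2
    exact Complex.continuous_ofReal.comp_aestronglyMeasurable this) (‖f‖ ^ 2) ?_
  have hb : ∀ᵐ t ∂μ, ‖f t‖ ≤ ‖f‖ := by
    filter_upwards [ae_le_eLpNormEssSup (f := f) (μ := μ)] with t ht
    rw [Lp.norm_def, eLpNorm_exponent_top]
    have := ENNReal.toReal_mono (by
      rw [← eLpNorm_exponent_top]
      exact (Lp.eLpNorm_lt_top f).ne) ht
    simpa using this
  filter_upwards [hb] with t ht
  rw [Complex.norm_real, Real.norm_of_nonneg (by positivity)]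
  gcongr

/-- The function `|f|²` as an element of `L^∞`. -/
noncomputable def normSq (f : Lp ℂ ∞ μ) : Lp ℂ ∞ μ := (memLp_norm_sq f).toLp _

theorem normSq_ae (f : Lp ℂ ∞ μ) : ∀ᵐ t ∂μ, normSq f t = ((‖f t‖ ^ 2 : ℝ) : ℂ) :=
  (memLp_norm_sq f).coeFn_toLp

theorem exists_conj (f : Lp ℂ ∞ μ) : ∃ h : Lp ℂ ∞ μ, ∀ᵐ t ∂μ, h t = star (f t) :=
  ⟨(Lp.memLp f).star.toLp _, (Lp.memLp f).star.coeFn_toLp⟩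

variable (Φ : LInftyModel τ A μ)

theorem θ_mul_star (f : Lp ℂ ∞ μ) : Φ.θ f * star (Φ.θ f) = Φ.θ (normSq f) := by
  obtain ⟨h, hh⟩ := exists_conj f
  rw [← Φ.map_star f h hh]
  refine (Φ.map_mul f h _ ?_).symm
  filter_upwards [hh, normSq_ae f] with t h1 h2
  rw [h1, h2, Complex.star_def, Complex.mul_conj, Complex.normSq_eq_norm_sq]

theorem star_θ_mul (f : Lp ℂ ∞ μ) : star (Φ.θ f) * Φ.θ f = Φ.θ (normSq f) := by
  obtain ⟨h, hh⟩ := exists_conj f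
  rw [← Φ.map_star f h hh]
  refine (Φ.map_mul h f _ ?_).symm
  filter_upwards [hh, normSq_ae f] with t h1 h2
  rw [h1, h2, Complex.star_def, mul_comm, Complex.mul_conj, Complex.normSq_eq_norm_sq]

theorem norm_hat_θ_sq (f : Lp ℂ ∞ μ) : ‖hat τ (Φ.θ f)‖ ^ 2 = ∫ t, ‖f t‖ ^ 2 ∂μ := by
  rw [norm_hat_sq_re, star_θ_mul, Φ.trace_eq, integral_congr_ae (normSq_ae f),
    integral_complex_ofReal, Complex.ofReal_re]

/-- The fourth moment of a bounded function is `‖ff*‖₂²`. -/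
theorem norm_hat_θ_mul_star_sq (f : Lp ℂ ∞ μ) :
    ‖hat τ (Φ.θ f * star (Φ.θ f))‖ ^ 2 = ∫ t, ‖f t‖ ^ 4 ∂μ := by
  rw [θ_mul_star, norm_hat_θ_sq]
  refine integral_congr_ae ?_
  filter_upwards [normSq_ae f] with t ht
  rw [ht, Complex.norm_real, Real.norm_of_nonneg (by positivity)]
  ring

/-- The bound `‖xf‖₂² ≤ ‖x‖ ‖x‖₂ ‖f‖₄²` for `f ∈ L⁴`, obtained by truncating `f`. -/
theorem norm_standardRep_sq_le (hτ : M.IsFaithfulNormalTracialState τ) (x : M) (f : Lp ℂ 2 μ)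
    (hf : Integrable (fun t => ‖f t‖ ^ 4) μ) :
    ‖standardRep τ x (Φ.U f)‖ ^ 2 ≤ ‖x‖ * ‖hat τ x‖ * √(∫ t, ‖f t‖ ^ 4 ∂μ) := by
  have hclosed : IsClosed {g : Lp ℂ 2 μ | ‖standardRep τ x (Φ.U g)‖ ^ 2 ≤
      ‖x‖ * ‖hat τ x‖ * √(∫ t, ‖f t‖ ^ 4 ∂μ)} :=
    isClosed_le (by have := Φ.U.continuous; fun_prop) continuous_const
  refine hclosed.closure_subset_iff.2 subset_rfl (Metric.mem_closure_iff.2 fun ε hε => ?_)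
  have hmeas : StronglyMeasurable f := Lp.stronglyMeasurable f
  obtain ⟨R, hR⟩ := (Lp.memLp f).eLpNorm_indicator_norm_ge_le hmeas (half_pos hε)
  -- Cut `f` off where it exceeds `R`.
  set s : Set X := {t | R ≤ ‖f t‖₊} with hs
  have hsm : MeasurableSet s := measurableSet_le measurable_const
    hmeas.measurable.nnnorm.coe_nnreal_real
  have hle : ∀ t, ‖sᶜ.indicator f t‖ ≤ ‖f t‖ := fun t => norm_indicator_le_norm_self _ _
  have hbd : ∀ t, ‖sᶜ.indicator f t‖ ≤ |R| := by
    intro t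
    by_cases ht : t ∈ s
    · rw [Set.indicator_of_notMem (by simpa using ht), norm_zero]
      exact abs_nonneg R
    · rw [Set.indicator_of_mem (by simpa using ht)]
      have ht' : ‖f t‖ < R := not_le.1 ht
      exact ht'.le.trans (le_abs_self R)
  have hmeas' : AEStronglyMeasurable (sᶜ.indicator f) μ :=
    (hmeas.indicator hsm.compl).aestronglyMeasurable
  have hinf : MemLp (sᶜ.indicator f) ∞ μ :=
    memLp_top_of_bound hmeas' |R| (Eventually.of_forall hbd)
  have htwo : MemLp (sᶜ.indicator f) 2 μ := (Lp.memLp f).indicator hsm.compl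
  set b : Lp ℂ ∞ μ := hinf.toLp _ with hb
  have hbae : b =ᵐ[μ] sᶜ.indicator f := hinf.coeFn_toLp
  refine ⟨htwo.toLp _, ?_, ?_⟩
  · have hU : Φ.U (htwo.toLp _) = hat τ (Φ.θ b) := by
      refine Φ.U_eq b _ ?_
      filter_upwards [htwo.coeFn_toLp, hbae] with t h1 h2
      rw [h1, h2]
    rw [Set.mem_ofPred_eq, hU, standardRep_hat]
    refine (norm_hat_mul_sq_le hτ x _).trans ?_
    gcongr
    refine Real.le_sqrt_of_sq_le ?_
    rw [norm_hat_θ_mul_star_sq]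
    refine integral_mono_of_nonneg (Eventually.of_forall fun t => by positivity) hf ?_
    filter_upwards [hbae] with t ht
    rw [ht]
    gcongr
    exact hle t
  · rw [dist_eq_norm]
    have hsub : f - htwo.toLp _ = ((Lp.memLp f).indicator hsm).toLp _ := by
      refine Lp.ext ?_
      filter_upwards [Lp.coeFn_sub f (htwo.toLp _), htwo.coeFn_toLp,
        ((Lp.memLp f).indicator hsm).coeFn_toLp] with t h1 h2 h3
      rw [h1, h3, Pi.sub_apply, h2, sub_eq_iff_eq_add]
      exact (congrFun (Set.indicator_self_add_compl s f) t).symm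
    rw [hsub, Lp.norm_toLp]
    exact (ENNReal.toReal_le_of_le_ofReal (half_pos hε).le hR).trans_lt (half_lt_self hε)

end LInftyModel

theorem norm_Lp_two_sq {X : Type*} [MeasurableSpace X] {μ : Measure X} (f : Lp ℂ 2 μ) :
    ‖f‖ ^ 2 = ∫ t, ‖f t‖ ^ 2 ∂μ := by
  have h : ((‖f‖ ^ 2 : ℝ) : ℂ) = ((∫ t, ‖f t‖ ^ 2 ∂μ : ℝ) : ℂ) := by
    rw [← integral_complex_ofReal]
    push_cast
    rw [← RCLike.ofReal_eq_complex_ofReal, ← inner_self_eq_norm_sq_to_K (𝕜 := ℂ), L2.inner_def]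
    refine integral_congr_ae (Eventually.of_forall fun t => ?_)
    dsimp only
    rw [inner_self_eq_norm_sq_to_K]
  exact_mod_cast h

/-! ### Gaussian projections -/

/-- The projection onto the closed span of independent identically distributed non-degenerate
Gaussian variables is smooth. It is not compact, since these variables have the same norm and
pairwise distance `√(2v)`. -/
theorem gaussian_spanProj (hτ : M.IsFaithfulNormalTracialState τ) {A : VonNeumannAlgebra K}
    {X : Type*} [MeasurableSpace X] {μ : Measure X} [IsProbabilityMeasure μ]
    (Φ : LInftyModel τ A μ) {g : ℕ → X → ℝ} {m : ℝ} {v : ℝ≥0} (hv : v ≠ 0)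
    (hind : iIndepFun g μ) (hg : ∀ n, HasLaw (g n) (gaussianReal m v) μ)
    {f : ℕ → Lp ℂ 2 μ} (hf : ∀ n, ∀ᵐ t ∂μ, f n t = (g n t : ℂ)) :
    spanProj (fun n => Φ.U (f n)) ∈ M.smoothPart (standardRep τ) ∧
      ¬ IsCompactOperator (spanProj (fun n => Φ.U (f n))) := by
  have hgauss : ∀ n, HasGaussianLaw (g n) μ := fun n => (hg n).hasGaussianLaw
  constructor
  · obtain ⟨κ, hκ, h4⟩ := exists_integral_norm_pow_four_le
    refine spanProj_mem_smoothPart hτ (Real.sqrt_nonneg κ) fun ζ hζ x => ?_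
    obtain ⟨N, c, rfl⟩ := mem_span_range_nat hζ
    simp_rw [← map_smul, ← map_sum]
    set F : Lp ℂ 2 μ := ∑ i ∈ Finset.range N, c i • f i with hF
    have hFae : ∀ᵐ t ∂μ, F t = ∑ i ∈ Finset.range N, c i * (g i t : ℂ) := by
      rw [hF]
      clear_value F
      clear hF hζ
      induction N with
      | zero => simp
      | succ n ih =>
        simp_rw [Finset.sum_range_succ]
        filter_upwards [ih, Lp.coeFn_add (∑ i ∈ Finset.range n, c i • f i) (c n • f n),
          Lp.coeFn_smul (c n) (f n), hf n] with t h1 h2 h3 h4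
        rw [h2, Pi.add_apply, h1, h3, Pi.smul_apply, h4, smul_eq_mul]
    obtain ⟨hint, hle⟩ := h4 hind hgauss N c
    have h4ae : (fun t => ‖F t‖ ^ 4) =ᵐ[μ]
        fun t => ‖∑ i ∈ Finset.range N, c i * (g i t : ℂ)‖ ^ 4 := by
      filter_upwards [hFae] with t ht
      rw [ht]
    have h2ae : (fun t => ‖F t‖ ^ 2) =ᵐ[μ]
        fun t => ‖∑ i ∈ Finset.range N, c i * (g i t : ℂ)‖ ^ 2 := by
      filter_upwards [hFae] with t ht
      rw [ht]
    rw [← integral_congr_ae h4ae, ← integral_congr_ae h2ae, ← norm_Lp_two_sq] at hle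
    refine (Φ.norm_standardRep_sq_le hτ x F (hint.congr h4ae.symm)).trans ?_
    calc ‖x‖ * ‖hat τ x‖ * √(∫ t, ‖F t‖ ^ 4 ∂μ)
        ≤ ‖x‖ * ‖hat τ x‖ * √(κ * (‖F‖ ^ 2) ^ 2) := by gcongr
      _ = √κ * (‖x‖ * ‖hat τ x‖) * ‖Φ.U F‖ ^ 2 := by
        rw [Real.sqrt_mul hκ, Real.sqrt_sq (by positivity), Φ.U.norm_map]
        ring
  · have hsq : ∀ n, ‖f n‖ ^ 2 = m ^ 2 + v := by
      intro n
      have h1 : ∫ t, ‖f n t‖ ^ 2 ∂μ = ∫ t, (g n ^ 2) t ∂μ := by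
        refine integral_congr_ae ?_
        filter_upwards [hf n] with t ht
        rw [ht, Complex.norm_real, Real.norm_eq_abs, sq_abs, Pi.pow_apply]
      have h2 := variance_eq_sub ((hgauss n).memLp_two)
      rw [(hg n).variance_eq, variance_id_gaussianReal, (hg n).integral_eq,
        integral_id_gaussianReal] at h2
      rw [norm_Lp_two_sq, h1]
      linarith
    have hinner : ∀ i j, i ≠ j → ⟪f i, f j⟫_ℂ = ((m ^ 2 : ℝ) : ℂ) := by
      intro i j hij
      have h1 : (fun t => ⟪f i t, f j t⟫_ℂ) =ᵐ[μ] fun t => ((g i t * g j t : ℝ) : ℂ) := by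
        filter_upwards [hf i, hf j] with t h1 h2
        rw [h1, h2, RCLike.inner_apply, Complex.conj_ofReal, ← Complex.ofReal_mul, mul_comm]
      rw [L2.inner_def, integral_congr_ae h1, integral_complex_ofReal,
        (hind.indepFun hij).integral_fun_mul_eq_mul_integral
          (hgauss i).aemeasurable.aestronglyMeasurable
          (hgauss j).aemeasurable.aestronglyMeasurable,
        (hg i).integral_eq, (hg j).integral_eq, integral_id_gaussianReal, sq]
    have hv' : (0 : ℝ) < v := by positivity
    refine not_isCompactOperator_spanProj (R := √(m ^ 2 + v)) (δ := √(2 * v)) (by positivity)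
      (fun n => ?_) fun i j hij => ?_
    · rw [Φ.U.norm_map]
      exact Real.le_sqrt_of_sq_le (hsq n).le
    · rw [← map_sub, Φ.U.norm_map]
      refine (Real.sqrt_le_left (norm_nonneg _)).2 ?_
      rw [norm_sub_sq (𝕜 := ℂ), hinner i j hij, hsq, hsq, RCLike.re_eq_complex_re,
        Complex.ofReal_re]
      linarith

/-! ### Smooth projections over abelian algebras -/

theorem norm_sum_smul_sq_of_orthonormal {E : Type*} [NormedAddCommGroup E] [InnerProductSpace ℂ E]
    {ι : Type*} {v : ι → E} (hv : Orthonormal ℂ v) (s : Finset ι) (c : ι → ℂ) :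
    ‖∑ i ∈ s, c i • v i‖ ^ 2 = ∑ i ∈ s, ‖c i‖ ^ 2 := by
  have h1 := hv.inner_sum c c s
  rw [inner_self_eq_norm_sq_to_K] at h1
  have h2 : ((‖∑ i ∈ s, c i • v i‖ ^ 2 : ℝ) : ℂ) = ((∑ i ∈ s, ‖c i‖ ^ 2 : ℝ) : ℂ) := by
    push_cast
    exact h1.trans (Finset.sum_congr rfl fun i _ => Complex.conj_mul' _)
  exact_mod_cast h2

/-- Over a commutative C*-algebra, the norm of `∑ xᵢ* xᵢ` is controlled by the norms of the linear
combinations of the `xᵢ`: at each character `φ`, choose the coefficients to be the conjugates of the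
values `φ(xᵢ)`. -/
theorem norm_sum_star_mul_le {B : Type*} [CommCStarAlgebra B] {ι : Type*} (s : Finset ι)
    (x : ι → B) {C : ℝ} (hC : 0 ≤ C)
    (h : ∀ c : ι → ℂ, ‖∑ i ∈ s, c i • x i‖ ^ 2 ≤ C * ∑ i ∈ s, ‖c i‖ ^ 2) :
    ‖∑ i ∈ s, star (x i) * x i‖ ≤ C := by
  rw [← gelfandTransform_isometry (A := B) |>.norm_map_of_map_zero (map_zero _)]
  refine (ContinuousMap.norm_le _ hC).2 fun φ => ?_
  have hval : WeakDual.gelfandTransform ℂ B (∑ i ∈ s, star (x i) * x i) φ =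
      ((∑ i ∈ s, ‖φ (x i)‖ ^ 2 : ℝ) : ℂ) := by
    rw [WeakDual.gelfandTransform_apply_apply, map_sum, Complex.ofReal_sum]
    refine Finset.sum_congr rfl fun i _ => ?_
    rw [map_mul, map_star, Complex.star_def, mul_comm, Complex.mul_conj,
      Complex.normSq_eq_norm_sq]
  set S : ℝ := ∑ i ∈ s, ‖φ (x i)‖ ^ 2 with hS
  have hS0 : 0 ≤ S := Finset.sum_nonneg fun i _ => by positivity
  rw [hval, Complex.norm_real, Real.norm_of_nonneg hS0]
  have h1 := h fun i => star (φ (x i))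
  simp only [norm_star, ← hS] at h1
  have h2 : φ (∑ i ∈ s, star (φ (x i)) • x i) = (S : ℂ) := by
    rw [map_sum, hS, Complex.ofReal_sum]
    refine Finset.sum_congr rfl fun i _ => ?_
    rw [map_smul, smul_eq_mul, Complex.star_def, mul_comm, Complex.mul_conj,
      Complex.normSq_eq_norm_sq]
  have h3 : S ≤ ‖∑ i ∈ s, star (φ (x i)) • x i‖ := by
    have h4 : ‖φ (∑ i ∈ s, star (φ (x i)) • x i)‖ ≤ ‖∑ i ∈ s, star (φ (x i)) • x i‖ :=
      NonUnitalStarAlgHom.norm_apply_le φ _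
    rwa [h2, Complex.norm_real, Real.norm_of_nonneg hS0] at h4
  have h5 : S * S ≤ C * S := by
    nlinarith
  rcases hS0.eq_or_lt with h0 | h0
  · rwa [← h0]
  · exact le_of_mul_le_mul_right h5 h0

theorem norm_sum_star_mul_le_of_isAbelian (hM : M.IsAbelian) {ι : Type*} (s : Finset ι)
    (x : ι → M) {C : ℝ} (hC : 0 ≤ C)
    (h : ∀ c : ι → ℂ, ‖∑ i ∈ s, c i • x i‖ ^ 2 ≤ C * ∑ i ∈ s, ‖c i‖ ^ 2) :
    ‖∑ i ∈ s, star (x i) * x i‖ ≤ C := by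
  let : CommCStarAlgebra M := { M.instCStarAlgebra with mul_comm := hM }
  exact norm_sum_star_mul_le s x hC h

/-- An s-smooth projection over an abelian algebra has finite rank: integrating the pointwise bound
`∑ |xᵢ|² ≤ C²` for an orthonormal family in the range shows that its cardinality is at most
`C²`. -/
theorem IsSSmooth.finiteDimensional (hτ : M.IsFaithfulNormalTracialState τ) (hM : M.IsAbelian)
    {p : L2 τ →L[ℂ] L2 τ} (hp : IsSSmooth τ p) :
    FiniteDimensional ℂ (LinearMap.range (p : L2 τ →ₗ[ℂ] L2 τ)) := by
  obtain ⟨-, C, hC, hx⟩ := hp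
  set V := LinearMap.range (p : L2 τ →ₗ[ℂ] L2 τ) with hV
  have hcard : ∀ (n : ℕ) (ξ : Fin n → V), Orthonormal ℂ ξ → (n : ℝ) ≤ C ^ 2 := by
    intro n ξ hξ
    have hξ' : Orthonormal ℂ fun i => (ξ i : L2 τ) := hξ.comp_linearIsometry V.subtypeₗᵢ
    choose x hxξ hxn using fun i => hx (ξ i) (ξ i).2
    have hbound : ∀ c : Fin n → ℂ, ‖∑ i, c i • x i‖ ^ 2 ≤ C ^ 2 * ∑ i, ‖c i‖ ^ 2 := by
      intro c
      have hsum : hat τ (∑ i, c i • x i) = ∑ i, c i • (ξ i : L2 τ) := by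
        rw [hat_sum]
        exact Finset.sum_congr rfl fun i _ => by rw [hat_smul, hxξ]
      obtain ⟨y, hy, hyn⟩ := hx (∑ i, c i • (ξ i : L2 τ))
        (V.sum_mem fun i _ => V.smul_mem _ (ξ i).2)
      have hyx : y = ∑ i, c i • x i := hat_injective hτ (hy.trans hsum.symm)
      have hnorm := norm_sum_smul_sq_of_orthonormal hξ' Finset.univ c
      rw [← hyx, ← hnorm, ← mul_pow]
      gcongr
    have h1 := norm_sum_star_mul_le_of_isAbelian hM Finset.univ x (sq_nonneg C) hbound
    have h2 : τ (∑ i, star (x i) * x i) = (n : ℂ) := by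
      rw [map_sum, Finset.sum_congr rfl (g := fun _ => (1 : ℂ))]
      · simp
      · intro i _
        rw [← norm_hat_sq, hxξ, hξ'.1 i]
        simp
    have h3 : ‖τ (∑ i, star (x i) * x i)‖ ≤ ‖∑ i, star (x i) * x i‖ := by
      have h4 := norm_trace_mul_le (τ := τ) 1 (∑ i, star (x i) * x i)
      rw [star_one, one_mul, norm_hat_one hτ, one_mul] at h4
      exact h4.trans (norm_hat_le hτ _)
    rw [h2, Complex.norm_natCast] at h3
    exact h3.trans h1
  by_contra hinf
  obtain ⟨n, hn⟩ := exists_nat_gt (C ^ 2)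
  have hrank : (n : Cardinal) ≤ Module.rank ℂ V := by
    refine (Cardinal.natCast_lt_aleph0 (n := n)).le.trans ?_
    by_contra hlt
    exact hinf (Module.rank_lt_aleph0_iff.1 (not_le.1 hlt))
  obtain ⟨b, hb⟩ := exists_linearIndependent_of_le_rank hrank
  exact absurd (hcard n _ (InnerProductSpace.gramSchmidtNormed_orthonormal hb)) (not_le.2 hn)

/-! ### Anticommuting unitaries -/

/-- For selfadjoint anticommuting unitaries, `x = ∑ cᵢ uᵢ` satisfies
`x* x + x x* = 2 ∑ |cᵢ|²`. -/
theorem norm_sum_smul_sq_le {u : ℕ → M} (hu : ∀ n, IsSelfAdjoint (u n))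
    (huu : ∀ n, u n * u n = 1) (hanti : ∀ i j, i ≠ j → u i * u j = -(u j * u i)) (N : ℕ)
    (c : ℕ → ℂ) :
    ‖∑ i ∈ Finset.range N, c i • u i‖ ^ 2 ≤ 2 * ∑ i ∈ Finset.range N, ‖c i‖ ^ 2 := by
  set x : M := ∑ i ∈ Finset.range N, c i • u i with hx
  set S : ℝ := ∑ i ∈ Finset.range N, ‖c i‖ ^ 2 with hS
  have hS0 : 0 ≤ S := Finset.sum_nonneg fun i _ => by positivity
  have hstar : star x = ∑ i ∈ Finset.range N, star (c i) • u i := by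
    rw [hx, star_sum]
    exact Finset.sum_congr rfl fun i _ => by rw [star_smul, (hu i).star_eq]
  have hsum : star x * x + x * star x = ((2 * S : ℝ) : ℂ) • (1 : M) := by
    rw [hstar, hx, Finset.sum_mul_sum, Finset.sum_mul_sum,
      Finset.sum_comm (f := fun i j => c i • u i * star (c j) • u j), ← Finset.sum_add_distrib]
    simp_rw [← Finset.sum_add_distrib, smul_mul_smul_comm]
    rw [hS, Finset.mul_sum, Complex.ofReal_sum, Finset.sum_smul]
    refine Finset.sum_congr rfl fun i hi => ?_
    rw [Finset.sum_eq_single_of_mem i hi]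
    · rw [huu, ← add_smul, mul_comm (c i), ← two_mul, Complex.star_def, Complex.conj_mul']
      push_cast
      rfl
    · intro j _ hj
      rw [hanti i j hj.symm, mul_comm (c j), smul_neg, neg_add_cancel]
  have hle : star x * x ≤ ((2 * S : ℝ) : ℂ) • (1 : M) := by
    rw [← hsum]
    exact le_add_of_nonneg_right (mul_star_self_nonneg x)
  rw [sq, ← CStarRing.norm_star_mul_self]
  refine (CStarAlgebra.norm_le_norm_of_nonneg_of_le (star_mul_self_nonneg x) hle).trans ?_
  rw [norm_smul, Complex.norm_real, Real.norm_of_nonneg (by positivity)]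
  exact mul_le_of_le_one_right (by positivity) (IsStarProjection.norm_le _ (IsStarProjection.one M))

/-- If `‖x‖ ≤ C ‖x‖₂` on the span of a sequence in `M`, the projection onto the closure of this span
in `L²M` is s-smooth: a `‖·‖₂`-Cauchy sequence in the span is Cauchy in norm. -/
theorem isSSmooth_spanProj (hτ : M.IsFaithfulNormalTracialState τ) {u : ℕ → M} {C : ℝ} (hC : 0 < C)
    (h : ∀ x ∈ Submodule.span ℂ (Set.range u), ‖x‖ ≤ C * ‖hat τ x‖) :
    IsSSmooth τ (spanProj fun n => hat τ (u n)) := by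
  refine ⟨isStarProjection_starProjection, C, hC, fun ξ hξ => ?_⟩
  have hξ' : ξ ∈ closure ((Submodule.span ℂ (Set.range fun n => hat τ (u n)) : Submodule ℂ (L2 τ)) :
      Set (L2 τ)) := by
    rw [← Submodule.topologicalClosure_coe, SetLike.mem_coe]
    have h1 : ξ ∈ (spanProj fun n => hat τ (u n)).range := hξ
    rwa [spanProj, Submodule.range_starProjection] at h1
  obtain ⟨ζ, hζ, hlim⟩ := mem_closure_iff_seq_limit.1 hξ'
  have hlift : ∀ n, ∃ x ∈ Submodule.span ℂ (Set.range u), hat τ x = ζ n := by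
    intro n
    have h1 : Submodule.span ℂ (Set.range fun n => hat τ (u n)) =
        (Submodule.span ℂ (Set.range u)).map (hatₗ τ) := by
      rw [Submodule.map_span, ← Set.range_comp]
      rfl
    have h2 := hζ n
    rw [h1] at h2
    exact h2
  choose x hxs hxζ using hlift
  have hcauchy : CauchySeq x := by
    refine Metric.cauchySeq_iff.2 fun ε hε => ?_
    obtain ⟨N, hN⟩ := Metric.cauchySeq_iff.1 hlim.cauchySeq (ε / C) (by positivity)
    refine ⟨N, fun m hm n hn => ?_⟩
    have h1 := hN m hm n hn
    rw [dist_eq_norm, ← hxζ, ← hxζ, ← hat_sub, lt_div_iff₀' hC] at h1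
    rw [dist_eq_norm]
    exact (h _ (sub_mem (hxs m) (hxs n))).trans_lt h1
  obtain ⟨y, hy⟩ := cauchySeq_tendsto_of_complete hcauchy
  have hhat : Tendsto (fun n => hat τ (x n)) atTop (𝓝 (hat τ y)) := by
    rw [tendsto_iff_norm_sub_tendsto_zero] at hy ⊢
    refine squeeze_zero (fun n => norm_nonneg _) (fun n => ?_) hy
    rw [← hat_sub]
    exact norm_hat_le hτ _
  have hyξ : hat τ y = ξ := tendsto_nhds_unique hhat (by simpa only [hxζ] using hlim)
  refine ⟨y, hyξ, ?_⟩
  rw [← hyξ]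
  exact le_of_tendsto_of_tendsto' hy.norm (hhat.norm.const_mul C) fun n => h _ (hxs n)

theorem orthonormal_of_anticommute (hτ : M.IsFaithfulNormalTracialState τ) {u : ℕ → M}
    (hu : ∀ n, IsSelfAdjoint (u n)) (huu : ∀ n, u n * u n = 1)
    (hanti : ∀ i j, i ≠ j → u i * u j = -(u j * u i)) : Orthonormal ℂ fun n => hat τ (u n) := by
  refine ⟨fun n => ?_, fun i j hij => ?_⟩
  · have h1 := norm_hat_sq_re (τ := τ) (u n)
    rw [(hu n).star_eq, huu, hτ.map_one, Complex.one_re] at h1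
    nlinarith [norm_nonneg (hat τ (u n))]
  · change ⟪hat τ (u i), hat τ (u j)⟫_ℂ = 0
    rw [inner_hat_hat, (hu i).star_eq]
    have h1 := congrArg τ (hanti i j hij)
    rw [map_neg, hτ.tracial (u j)] at h1
    exact self_eq_neg.1 h1

theorem isSSmooth_spanProj_of_anticommute (hτ : M.IsFaithfulNormalTracialState τ) {u : ℕ → M}
    (hu : ∀ n, IsSelfAdjoint (u n)) (huu : ∀ n, u n * u n = 1)
    (hanti : ∀ i j, i ≠ j → u i * u j = -(u j * u i)) :
    IsSSmooth τ (spanProj fun n => hat τ (u n)) := by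
  refine isSSmooth_spanProj hτ (C := √2) (by positivity) fun x hx => ?_
  obtain ⟨N, c, rfl⟩ := mem_span_range_nat hx
  refine le_of_sq_le_sq ((norm_sum_smul_sq_le hu huu hanti N c).trans_eq ?_) (by positivity)
  rw [mul_pow, Real.sq_sqrt zero_le_two, hat_sum]
  simp_rw [hat_smul]
  congr 1
  exact (norm_sum_smul_sq_of_orthonormal (orthonormal_of_anticommute hτ hu huu hanti) _ c).symm

end VonNeumannAlgebra

theorem proposition1p6 {K : Type*} [NormedAddCommGroup K] [InnerProductSpace ℂ K]
    [CompleteSpace K] (M : VonNeumannAlgebra K) (τ : M →ₚ[ℂ] ℂ)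
    (hτ : M.IsFaithfulNormalTracialState τ) :
    -- the atomic case
    (M.IsAtomicVN →
      M.smoothPart (standardRep τ) = {T : L2 τ →L[ℂ] L2 τ | IsCompactOperator T}) ∧
    -- the diffuse case: Gaussian projections
    (M.IsDiffuse →
      (∀ A : VonNeumannAlgebra K, A ≤ M → A.IsAbelian → A.IsDiffuse →
        TopologicalSpace.IsSeparable (hat τ '' {x : M | (x : K →L[ℂ] K) ∈ A}) →
        ∀ {X : Type*} [MeasurableSpace X] (μ : Measure X) [IsProbabilityMeasure μ]
          (Φ : LInftyModel τ A μ) (g : ℕ → X → ℝ) (m : ℝ) (v : ℝ≥0), v ≠ 0 →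
          iIndepFun g μ → (∀ n, HasLaw (g n) (gaussianReal m v) μ) →
          ∀ f : ℕ → Lp ℂ 2 μ, (∀ n, ∀ᵐ t ∂μ, f n t = (g n t : ℂ)) →
            spanProj (fun n => Φ.U (f n)) ∈ M.smoothPart (standardRep τ) ∧
            ¬ IsCompactOperator (spanProj (fun n => Φ.U (f n)))) ∧
      {T : L2 τ →L[ℂ] L2 τ | IsCompactOperator T} ⊂ M.smoothPart (standardRep τ)) ∧
    -- the diffuse abelian case
    (M.IsDiffuse → M.IsAbelian → ∀ p : L2 τ →L[ℂ] L2 τ, IsSSmooth τ p →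
      FiniteDimensional ℂ (LinearMap.range (p : L2 τ →ₗ[ℂ] L2 τ))) ∧
    -- the type II₁ case: CAR projections
    (M.IsTypeII1 → ∀ u : ℕ → M, (∀ n, u n ∈ unitary M) → (∀ n, IsSelfAdjoint (u n)) →
      (∀ n, τ (u n) = 0) → (∀ i j, i ≠ j → u i * u j = -(u j * u i)) →
        Orthonormal ℂ (fun n => hat τ (u n)) ∧
        IsSSmooth τ (spanProj (fun n => hat τ (u n))) ∧
        ¬ FiniteDimensional ℂ (LinearMap.range
          (spanProj (fun n => hat τ (u n)) : L2 τ →ₗ[ℂ] L2 τ))) := by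
  refine ⟨fun hM => Set.Subset.antisymm (fun T hT => hM.isCompactOperator hτ hT)
    fun T hT => mem_smoothPart_of_isCompactOperator hτ hT, fun hM => ⟨?_, ?_⟩,
    fun _ hM p hp => hp.finiteDimensional hτ hM, fun _ u huni hu _ hanti => ?_⟩
  · intro A _ _ _ _ X _ μ _ Φ g m v hv hind hg f hf
    exact gaussian_spanProj hτ Φ hv hind hg hf
  · obtain ⟨T, hT, hTc⟩ := hM.exists_mem_smoothPart hτ
    exact ⟨fun T hT => mem_smoothPart_of_isCompactOperator hτ hT, fun h => hTc (h hT)⟩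
  · have huu : ∀ n, u n * u n = 1 := fun n => by
      have h := Unitary.star_mul_self_of_mem (huni n)
      rwa [(hu n).star_eq] at h
    have hort := orthonormal_of_anticommute hτ hu huu hanti
    refine ⟨hort, isSSmooth_spanProj_of_anticommute hτ hu huu hanti, fun hfin => ?_⟩
    exact not_isCompactOperator_spanProj_of_orthonormal hort
      (isCompactOperator_of_forall_mem fun ξ => LinearMap.mem_range_self _ ξ)
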